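/- **Setting.** Let $d\ge 1$, $r,p\ge 0$ be integers. On a probability space let $X_t=\Lambda f_t+\varepsilon_t$ $(t\in\mathbb Z)$ be a $d$-dimensional dynamic factor model whose $r$-dimensional factors $\{f_t\}$ form a zero mean, square integrable, (weakly) stationary series with $$f_t=\sum_{i=1}^p\Phi_i f_{t-i}+\eta_t ,$$ where $\Phi_i\in\mathbb R^{r\times r}$, $\{\eta_t\}\sim \mathrm{WN}(0,\Sigma_\eta)$, $\{\varepsilon_t\}\sim\mathrm{WN}(0,I_d)$, $E\,\varepsilon_s f_t'=0$ for all $s,t$, and $\Lambda\in\mathbb R^{d\times r}$ satisfies $\Lambda'\Lambda=d\,I_r$. (All identities between random vectors are almost sure; $\mathrm{WN}(0,S)$ means zero mean, square integrable, uncorrelated over time, with covariance matrix $S$.) Put $\widetilde\Phi_i=\frac1d\Lambda\Phi_i\Lambda'$ and $$Z_t=\Lambda\eta_t+\varepsilon_t-\sum_{i=1}^p\widetilde\Phi_i\varepsilon_{t-i}.$$ For a zero mean stationary series $Y$ with $\Gamma_Y(h)=E\,Y_{t+h}Y_t'$, the innovations algorithm defines matrices by $\Sigma_0=\Gamma_Y(0)$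 and $$\Theta_{n,n-k}=\Big(\Gamma_Y(n-k)-\sum_{j=0}^{k-1}\Theta_{n,n-j}\Sigma_j\Theta_{k,k-j}'\Big)\Sigma_k^{-1}\ (0\le k<n),\qquad \Sigma_n=\Gamma_Y(0)-\sum_{j=0}^{n-1}\Theta_{n,n-j}\Sigma_j\Theta_{n,n-j}' .$$ **Theorem.** $\{Z_t\}$ is zero mean and stationary, and every $\Sigma_n$ produced by the innovations algorithm for $\Gamma_Z$ is positive definite. There are a series $\{\zeta_t\}\sim\mathrm{WN}(0,\Sigma_\zeta)$ on the same probability space, with $\Sigma_\zeta$ positive definite, and matrices $\Theta_1,\dots,\Theta_p\in\mathbb R^{d\times d}$ such that $$Z_t=\zeta_t+\sum_{i=1}^p\Theta_i\zeta_{t-i}\qquad(t\in\mathbb Z),$$ and the following hold. 1. $\Sigma_\zeta=\lim_{n\to\infty}\Sigma_n$. 2. $\Theta_i=\lim_{n\to\infty}\Theta_{n,i}$ for $i=1,\dots,p$. 3. With $-\widetilde\Phi_0=\Theta_0=I_d$, the tuple $(\Sigma_\zeta,\Theta_1,\dots,\Theta_p)$ solves the system $$\Gamma_Z(0)=\Lambda\Sigma_\eta\Lambda'+I_d+\sum_{i=1}^p\widetilde\Phi_i\widetilde\Phi_i'=\Sigma_\zeta+\sum_{i=1}^p\Theta_i\Sigma_\zeta\Theta_i',$$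 $$\Gamma_Z(h)=\sum_{i=0}^{p-h}\widetilde\Phi_{i+h}\widetilde\Phi_i'=\sum_{i=0}^{p-h}\Theta_{i+h}\Sigma_\zeta\Theta_i',\qquad h=1,\dots,p .$$ It is the solution with maximal $\Sigma_\zeta$: for every solution $(\Sigma',\Theta_1',\dots,\Theta_p')$ with $\Sigma'$ symmetric, $\Sigma_\zeta-\Sigma'$ is positive semidefinite, and if $\Sigma'=\Sigma_\zeta$ then $\Theta_i'=\Theta_i$ for all $i$. 4. The representation is invertible: each $\zeta_t$ is a mean square limit of linear combinations of the components of $Z_t,Z_{t-1},\dots$. If $\Sigma_\eta$ is positive definite, or if $\det(I_r-\sum_{i=1}^p\Phi_iz^i)\neq0$ for all $z\in\mathbb C$ with $|z|=1$, then moreover $\det(I_d+\sum_{i=1}^p\Theta_iz^i)\ne0$ for all $|z|\le1$, and $\zeta_t=\sum_{j\ge0}P_jZ_{t-j}$ almost surely for some absolutely summable matrices $P_j$. The same statements hold for the $r$-dimensional series $W_t=\frac1{\sqrt d}\Lambda'Z_t$ (with its own white noise, covariance limit, coefficient limits, and innovations algorithm for $\Gamma_W$), where $I_d$ is replaced by $I_r$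 and the system is the one whose left-hand sides are $\Gamma_W(0)=I_r+d\,\Sigma_\eta+\sum_{i=1}^p\Phi_i\Phi_i'$ and $\Gamma_W(h)=\sum_{i=0}^{p-h}\Phi_{i+h}\Phi_i'$, $h=1,\dots,p$, with $\Phi_0=-I_r$. -/

import Mathlib

open MeasureTheory Filter Topology

noncomputable section

/-! ### Second-order time series -/

/-- The matrix `E U V'` of two random vectors. -/
def crossMoment {Ω : Type*} [MeasurableSpace Ω] (μ : Measure Ω) {m n : ℕ}
    (U : Ω → Fin m → ℝ) (V : Ω → Fin n → ℝ) : Matrix (Fin m) (Fin n) ℝ :=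
  Matrix.of fun a b => ∫ ω, U ω a * V ω b ∂μ

/-- `u ∼ WN(0, S)`: square integrable, centred, uncorrelated over time, covariance matrix `S`. -/
structure IsWhiteNoise {Ω : Type*} [MeasurableSpace Ω] (μ : Measure Ω) {n : ℕ}
    (u : ℤ → Ω → Fin n → ℝ) (S : Matrix (Fin n) (Fin n) ℝ) : Prop where
  memLp : ∀ t a, MemLp (fun ω => u t ω a) 2 μ
  mean_zero : ∀ t a, ∫ ω, u t ω a ∂μ = 0
  uncorrelated : ∀ s t, s ≠ t → crossMoment μ (u s) (u t) = 0
  covariance : ∀ t, crossMoment μ (u t) (u t) = S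

/-- Zero mean, (weakly) stationary vector time series. -/
structure IsZeroMeanStationary {Ω : Type*} [MeasurableSpace Ω] (μ : Measure Ω) {n : ℕ}
    (u : ℤ → Ω → Fin n → ℝ) : Prop where
  memLp : ∀ t a, MemLp (fun ω => u t ω a) 2 μ
  mean_zero : ∀ t a, ∫ ω, u t ω a ∂μ = 0
  shift : ∀ s t h : ℤ, crossMoment μ (u (s + h)) (u s) = crossMoment μ (u (t + h)) (u t)

/-- The autocovariance function `Γ_Y(h) = E Y_{t+h} Y_t'` of a zero mean stationary series
(it does not depend on `t`, so it is read off at `t = 0`). -/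
def acvf {Ω : Type*} [MeasurableSpace Ω] (μ : Measure Ω) {n : ℕ}
    (Y : ℤ → Ω → Fin n → ℝ) (h : ℤ) : Matrix (Fin n) (Fin n) ℝ :=
  crossMoment μ (Y h) (Y 0)

/-! ### The dynamic factor model -/

/-- `X_t = Λ f_t + ε_t` with a zero mean stationary factor series that follows the VAR equation
`f_t = ∑_{i=1}^p Φ_i f_{t-i} + η_t`, in the normalization `Σ_ε = I_d`, `Λ'Λ = d I_r`; `Qη` is the covariance matrix of `η_t`.
Of the family `Φ` only the values at `1, …, p` matter. -/
structure IsDFM {Ω : Type*} [MeasurableSpace Ω] (μ : Measure Ω) {d r : ℕ} (p : ℕ)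
    (Λ : Matrix (Fin d) (Fin r) ℝ) (Φ : ℕ → Matrix (Fin r) (Fin r) ℝ)
    (Qη : Matrix (Fin r) (Fin r) ℝ)
    (X : ℤ → Ω → Fin d → ℝ) (f : ℤ → Ω → Fin r → ℝ)
    (η : ℤ → Ω → Fin r → ℝ) (ε : ℤ → Ω → Fin d → ℝ) : Prop where
  factor_model : ∀ t, ∀ᵐ ω ∂μ, X t ω = Λ.mulVec (f t ω) + ε t ω
  factor_stationary : IsZeroMeanStationary μ f
  factor_var : ∀ t, ∀ᵐ ω ∂μ,
    f t ω = (∑ i ∈ Finset.Icc 1 p, (Φ i).mulVec (f (t - (i : ℤ)) ω)) + η t ω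
  noise_factor : IsWhiteNoise μ η Qη
  noise_error : IsWhiteNoise μ ε 1
  error_factor_uncorrelated : ∀ s t, crossMoment μ (ε s) (f t) = 0
  loadings : Λ.transpose * Λ = (d : ℝ) • (1 : Matrix (Fin r) (Fin r) ℝ)

/-- `Φ̃ = (1/d) Λ Φ Λ'`. -/
def liftedCoef {d r : ℕ} (Λ : Matrix (Fin d) (Fin r) ℝ) (A : Matrix (Fin r) (Fin r) ℝ) :
    Matrix (Fin d) (Fin d) ℝ :=
  (1 / (d : ℝ)) • (Λ * A * Λ.transpose)

/-- `Z_t = Λ η_t + ε_t - ∑_{i=1}^p Φ̃_i ε_{t-i}`. -/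
def residualSeries {Ω : Type*} {d r : ℕ} (p : ℕ)
    (Λ : Matrix (Fin d) (Fin r) ℝ) (Φ : ℕ → Matrix (Fin r) (Fin r) ℝ)
    (η : ℤ → Ω → Fin r → ℝ) (ε : ℤ → Ω → Fin d → ℝ) : ℤ → Ω → Fin d → ℝ :=
  fun t ω => Λ.mulVec (η t ω) + ε t ω
    - ∑ i ∈ Finset.Icc 1 p, (liftedCoef Λ (Φ i)).mulVec (ε (t - (i : ℤ)) ω)

/-- `(1/√d) Λ' Z_t`. -/
def reducedSeries {Ω : Type*} {d r : ℕ} (Λ : Matrix (Fin d) (Fin r) ℝ)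
    (Z : ℤ → Ω → Fin d → ℝ) : ℤ → Ω → Fin r → ℝ :=
  fun t ω => (1 / Real.sqrt (d : ℝ)) • Λ.transpose.mulVec (Z t ω)

/-- The family `A` with its value at index `0` replaced by `A₀`. -/
def withZeroth {n : ℕ} (A₀ : Matrix (Fin n) (Fin n) ℝ) (A : ℕ → Matrix (Fin n) (Fin n) ℝ) :
    ℕ → Matrix (Fin n) (Fin n) ℝ :=
  fun i => if i = 0 then A₀ else A i

/-- The matrix polynomial `I + ∑_{i=1}^p A_i z^i` at a complex point. -/
def matrixPoly {n : ℕ} (p : ℕ) (A : ℕ → Matrix (Fin n) (Fin n) ℝ) (z : ℂ) :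
    Matrix (Fin n) (Fin n) ℂ :=
  1 + ∑ i ∈ Finset.Icc 1 p, z ^ i • (A i).map (fun x : ℝ => (x : ℂ))

/-! ### The innovations algorithm -/

/- `innovCov Γ n` is `Σ_n`, and `innovCoefRev Γ n k` is `Θ_{n,n-k}` for `k < n`. -/
mutual

def innovCov {m : ℕ} (Γ : ℤ → Matrix (Fin m) (Fin m) ℝ) (n : ℕ) : Matrix (Fin m) (Fin m) ℝ :=
  Γ 0 - ∑ j : Fin n, innovCoefRev Γ n j * innovCov Γ j * (innovCoefRev Γ n j).transpose
termination_by (n, n)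
decreasing_by
  all_goals first
    | exact Prod.Lex.left _ _ j.isLt
    | exact Prod.Lex.right _ j.isLt

def innovCoefRev {m : ℕ} (Γ : ℤ → Matrix (Fin m) (Fin m) ℝ) (n k : ℕ) :
    Matrix (Fin m) (Fin m) ℝ :=
  if _h : k < n then
    (Γ ((n : ℤ) - (k : ℤ))
      - ∑ j : Fin k, innovCoefRev Γ n j * innovCov Γ j * (innovCoefRev Γ k j).transpose)
      * (innovCov Γ k)⁻¹
  else 0
termination_by (n, k)
decreasing_by
  all_goals first
    | exact Prod.Lex.right _ j.isLt
    | exact Prod.Lex.left _ _ (lt_trans j.isLt _h)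
    | exact Prod.Lex.left _ _ _h

end

/-- `Θ_{n,i}` of the innovations algorithm, for `1 ≤ i ≤ n`. -/
def innovCoef {m : ℕ} (Γ : ℤ → Matrix (Fin m) (Fin m) ℝ) (n i : ℕ) : Matrix (Fin m) (Fin m) ℝ :=
  if i ≤ n then innovCoefRev Γ n (n - i) else 0

theorem innovCov_zero {m : ℕ} (Γ : ℤ → Matrix (Fin m) (Fin m) ℝ) : innovCov Γ 0 = Γ 0 := by
  rw [innovCov]
  simp

theorem innovCoefRev_eq {m : ℕ} (Γ : ℤ → Matrix (Fin m) (Fin m) ℝ) {n k : ℕ} (h : k < n) :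
    innovCoefRev Γ n k = innovCoef Γ n (n - k) := by
  rw [innovCoef, if_pos (Nat.sub_le n k), Nat.sub_sub_self h.le]

theorem innovCoef_eq {m : ℕ} (Γ : ℤ → Matrix (Fin m) (Fin m) ℝ) {n k : ℕ} (h : k < n) :
    innovCoef Γ n (n - k) =
      (Γ ((n : ℤ) - (k : ℤ)) - ∑ j ∈ Finset.range k,
        innovCoef Γ n (n - j) * innovCov Γ j * (innovCoef Γ k (k - j)).transpose)
        * (innovCov Γ k)⁻¹ := by
  rw [← innovCoefRev_eq Γ h, innovCoefRev, dif_pos h, Finset.sum_range]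
  congr 2
  refine Finset.sum_congr rfl fun j _ => ?_
  rw [innovCoefRev_eq Γ (lt_trans j.isLt h), innovCoefRev_eq Γ j.isLt]

theorem innovCov_eq {m : ℕ} (Γ : ℤ → Matrix (Fin m) (Fin m) ℝ) (n : ℕ) :
    innovCov Γ n = Γ 0 - ∑ j ∈ Finset.range n,
      innovCoef Γ n (n - j) * innovCov Γ j * (innovCoef Γ n (n - j)).transpose := by
  rw [innovCov, Finset.sum_range]
  congr 1
  refine Finset.sum_congr rfl fun j _ => ?_
  rw [innovCoefRev_eq Γ j.isLt]

/-! ### VMA representations -/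

/-- `Y_t = ζ_t + ∑_{i=1}^p Θ_i ζ_{t-i}` with `ζ ∼ WN(0, S)`. -/
structure IsVMA {Ω : Type*} [MeasurableSpace Ω] (μ : Measure Ω) {n : ℕ} (p : ℕ)
    (Y ζ : ℤ → Ω → Fin n → ℝ) (S : Matrix (Fin n) (Fin n) ℝ)
    (Θ : ℕ → Matrix (Fin n) (Fin n) ℝ) : Prop where
  noise : IsWhiteNoise μ ζ S
  representation : ∀ t, ∀ᵐ ω ∂μ,
    Y t ω = ζ t ω + ∑ i ∈ Finset.Icc 1 p, (Θ i).mulVec (ζ (t - (i : ℤ)) ω)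

/-- Every `ζ_t` is a mean square limit of linear combinations of `Y_t, Y_{t-1}, …`:
invertibility in the generalized sense. -/
def IsInPastSpan {Ω : Type*} [MeasurableSpace Ω] (μ : Measure Ω) {n : ℕ}
    (Y ζ : ℤ → Ω → Fin n → ℝ) : Prop :=
  ∀ t, ∀ δ : ℝ, 0 < δ → ∃ (N : ℕ) (A : ℕ → Matrix (Fin n) (Fin n) ℝ), ∀ a,
    ∫ ω, (ζ t ω a - (∑ j ∈ Finset.range N, (A j).mulVec (Y (t - (j : ℤ)) ω)) a) ^ 2 ∂μ < δ

/-- Invertibility: `ζ_t = ∑_{j ≥ 0} P_j Y_{t-j}` almost surely, with absolutely summable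
coefficient matrices. -/
def IsInvertibleIn {Ω : Type*} [MeasurableSpace Ω] (μ : Measure Ω) {n : ℕ}
    (Y ζ : ℤ → Ω → Fin n → ℝ) : Prop :=
  ∃ P : ℕ → Matrix (Fin n) (Fin n) ℝ, (∀ a b, Summable fun j => |P j a b|) ∧
    ∀ t, ∀ᵐ ω ∂μ, ∀ a,
      HasSum (fun j : ℕ => (P j).mulVec (Y (t - (j : ℤ)) ω) a) (ζ t ω a)

/-- The matrix system that equates the autocovariances `Γ(0), …, Γ(p)` with those of a VMA(p)
series with error covariance `S` and coefficients `Θ_1, …, Θ_p` (and `Θ_0 = I`). -/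
structure SolvesVMASystem {n : ℕ} (p : ℕ) (Γ : ℤ → Matrix (Fin n) (Fin n) ℝ)
    (S : Matrix (Fin n) (Fin n) ℝ) (Θ : ℕ → Matrix (Fin n) (Fin n) ℝ) : Prop where
  symmetric : S.IsSymm
  lag_zero : Γ 0 = S + ∑ i ∈ Finset.Icc 1 p, Θ i * S * (Θ i).transpose
  lag_pos : ∀ h ∈ Finset.Icc 1 p, Γ (h : ℤ) = ∑ i ∈ Finset.range (p - h + 1),
    withZeroth 1 Θ (i + h) * S * (withZeroth 1 Θ i).transpose

/-- `(S, Θ)` is the solution whose `S` is maximal: it solves the system, `S` dominates the error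
covariance of every solution, and no other solution has this `S`. -/
def IsTheMaximalSolution {n : ℕ} (p : ℕ) (Γ : ℤ → Matrix (Fin n) (Fin n) ℝ)
    (S : Matrix (Fin n) (Fin n) ℝ) (Θ : ℕ → Matrix (Fin n) (Fin n) ℝ) : Prop :=
  SolvesVMASystem p Γ S Θ ∧
    ∀ S' Θ', SolvesVMASystem p Γ S' Θ' →
      (S - S').PosSemidef ∧ (S' = S → ∀ i ∈ Finset.Icc 1 p, Θ' i = Θ i)

end

-- Both series have the form `Y_t = u_t + e_t - ∑ A_i e_{t-i}`, with `u` and `e` uncorrelated white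
-- noises of covariance `R` and `I`. For `Z` these are `Λη`, `ε` and the lifted coefficients. For
-- `W` they are `√d η`, `Λ'ε/√d` and `Φ_i`. All assertions are proved for this form in
-- `vma_of_noise_add_movingAverage`, working in the real Hilbert space `L²`.
--
-- The innovations algorithm is block Gram-Schmidt: `Σ_n` is the Gram matrix of the prediction error
-- from `n` past values. Since `e_t` is orthogonal to the past of `Y` and `E Y_t e_t' = I`,
-- subtracting `e_t` from that error leaves Gram matrix `Σ_n - I`. Hence `Σ_n ≥ I` for every `n`, so
-- all inverses exist and the bound survives in the limit (`innovCov_sub_one_posSemidef`).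
-- Projections on growing finite pasts converge to the projection on the infinite past, so `Σ_n` and
-- `Θ_{n,i}` converge to moments of the errors `wold` (`tendsto_innovCov`, `tendsto_innovCoef`).
-- Because `Γ` vanishes beyond lag `p`, the series is a moving average of these errors
-- (`eq_wold_add_sum`).
--
-- Maximality: on the unit circle any solution satisfies `Θ'(z) S' Θ'(z)* = R + A(z) A(z)*`, where
-- `A(z) = I - ∑ A_i z^i`. The right side is positive definite at some `z`, so the symmetric `S'` is
-- positive definite (`posDef_of_spectral`). Then `S' = C'C`, and `C'e` is a white noise whose
-- moving average has the autocovariances `Γ`. Its innovations algorithm has the same limits, and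
-- its infinite-past error minus `C'e` has Gram matrix `S - S'` (`maximal_of_tendsto`).
--
-- Invertibility: a zero of `det Θ` inside the disc would yield a vector orthogonal to the past and
-- present of `Y` but not to `ζ_0` (`det_ne_zero_of_norm_lt_one`). On the circle a null vector of
-- `Θ(z)*` is annihilated by `R` and by `A(z)*`, which the regularity hypothesis excludes. The
-- adjugate divided by the determinant then gives summable coefficients.

noncomputable section

/-! ### Matrices acting on vectors of a Hilbert space -/

section Gram

variable {E : Type*} [NormedAddCommGroup E] [InnerProductSpace ℝ E]

/-- The matrix `A` applied to a vector with entries in `E`. -/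
def matAct {m n : ℕ} (A : Matrix (Fin m) (Fin n) ℝ) (x : Fin n → E) : Fin m → E :=
  fun a => ∑ b, A a b • x b

/-- The matrix of inner products of two finite families. -/
def crossGram {m n : ℕ} (x : Fin m → E) (y : Fin n → E) : Matrix (Fin m) (Fin n) ℝ :=
  Matrix.of fun a b => inner ℝ (x a) (y b)

theorem crossGram_apply {m n : ℕ} (x : Fin m → E) (y : Fin n → E) (a : Fin m) (b : Fin n) :
    crossGram x y a b = inner ℝ (x a) (y b) := rfl

theorem crossGram_transpose {m n : ℕ} (x : Fin m → E) (y : Fin n → E) :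
    (crossGram x y).transpose = crossGram y x := by
  ext a b
  simp [crossGram, real_inner_comm]

theorem crossGram_add_left {m n : ℕ} (x x' : Fin m → E) (y : Fin n → E) :
    crossGram (x + x') y = crossGram x y + crossGram x' y := by
  ext a b
  simp [crossGram, inner_add_left]

theorem crossGram_sub_left {m n : ℕ} (x x' : Fin m → E) (y : Fin n → E) :
    crossGram (x - x') y = crossGram x y - crossGram x' y := by
  ext a b
  simp [crossGram, inner_sub_left]

theorem crossGram_sum_left {ι : Type*} {m n : ℕ} (s : Finset ι) (x : ι → Fin m → E)
    (y : Fin n → E) :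
    crossGram (∑ i ∈ s, x i) y = ∑ i ∈ s, crossGram (x i) y := by
  ext a b
  simp [crossGram, sum_inner, Matrix.sum_apply]

theorem crossGram_matAct_left {k m n : ℕ} (A : Matrix (Fin k) (Fin m) ℝ) (x : Fin m → E)
    (y : Fin n → E) : crossGram (matAct A x) y = A * crossGram x y := by
  ext a b
  simp [crossGram, matAct, sum_inner, Matrix.mul_apply, real_inner_smul_left]

theorem crossGram_add_right {m n : ℕ} (x : Fin m → E) (y y' : Fin n → E) :
    crossGram x (y + y') = crossGram x y + crossGram x y' := by
  rw [← crossGram_transpose, crossGram_add_left, Matrix.transpose_add, crossGram_transpose,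
    crossGram_transpose]

theorem crossGram_sub_right {m n : ℕ} (x : Fin m → E) (y y' : Fin n → E) :
    crossGram x (y - y') = crossGram x y - crossGram x y' := by
  rw [← crossGram_transpose, crossGram_sub_left, Matrix.transpose_sub, crossGram_transpose,
    crossGram_transpose]

theorem crossGram_sum_right {ι : Type*} {m n : ℕ} (s : Finset ι) (x : Fin m → E)
    (y : ι → Fin n → E) :
    crossGram x (∑ i ∈ s, y i) = ∑ i ∈ s, crossGram x (y i) := by
  rw [← crossGram_transpose, crossGram_sum_left, Matrix.transpose_sum]
  simp [crossGram_transpose]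

theorem crossGram_matAct_right {k m n : ℕ} (A : Matrix (Fin k) (Fin n) ℝ) (x : Fin m → E)
    (y : Fin n → E) : crossGram x (matAct A y) = crossGram x y * A.transpose := by
  rw [← crossGram_transpose, crossGram_matAct_left, Matrix.transpose_mul, crossGram_transpose]

theorem crossGram_self_posSemidef {m : ℕ} (x : Fin m → E) : (crossGram x x).PosSemidef := by
  refine Matrix.PosSemidef.of_dotProduct_mulVec_nonneg ?_ fun c => ?_
  · rw [Matrix.IsHermitian, Matrix.conjTranspose_eq_transpose_of_trivial, crossGram_transpose]
  · have : star c ⬝ᵥ (crossGram x x).mulVec c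
        = inner ℝ (∑ a, c a • x a) (∑ a, c a • x a) := by
      simp only [sum_inner, inner_sum, dotProduct, Matrix.mulVec, crossGram_apply,
        real_inner_smul_left, real_inner_smul_right, Finset.mul_sum, star_trivial]
      rw [Finset.sum_comm]
      refine Finset.sum_congr rfl fun a _ => Finset.sum_congr rfl fun b _ => ?_
      rw [real_inner_comm]
      ring
    rw [this]
    exact real_inner_self_nonneg

theorem eq_of_crossGram_sub_eq_zero {m : ℕ} {x y : Fin m → E}
    (h : crossGram (x - y) (x - y) = 0) : x = y := by
  funext a
  have := congrFun (congrFun h a) a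
  rw [crossGram_apply, Matrix.zero_apply, inner_self_eq_zero] at this
  exact sub_eq_zero.1 this

theorem matAct_one {m : ℕ} (x : Fin m → E) : matAct 1 x = x := by
  funext a
  simp [matAct, Matrix.one_apply]

theorem matAct_mem {m n : ℕ} (A : Matrix (Fin m) (Fin n) ℝ) (x : Fin n → E)
    (K : Submodule ℝ E) (h : ∀ b, x b ∈ K) (a : Fin m) : matAct A x a ∈ K :=
  K.sum_mem fun b _ => K.smul_mem _ (h b)

/-! ### The innovations algorithm in a Hilbert space -/

/-- The innovations of the sequence `x` that the innovations algorithm for `Γ` produces. -/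
def innov {n : ℕ} (Γ : ℤ → Matrix (Fin n) (Fin n) ℝ) (x : ℕ → Fin n → E) (k : ℕ) : Fin n → E :=
  x k - ∑ j : Fin k, matAct (innovCoef Γ k (k - j)) (innov Γ x j)
termination_by k
decreasing_by exact j.isLt

theorem innov_eq {n : ℕ} (Γ : ℤ → Matrix (Fin n) (Fin n) ℝ) (x : ℕ → Fin n → E) (k : ℕ) :
    innov Γ x k
      = x k - ∑ j ∈ Finset.range k, matAct (innovCoef Γ k (k - j)) (innov Γ x j) := by
  rw [innov, Finset.sum_range]

/-- Expanding the innovation at step `k` by its recursion reproduces the bracket that defines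
`Θ_{m,m-k}`. Invertibility of `Σ_k` cancels the inverse there. -/
theorem crossGram_innov {n : ℕ} {Γ : ℤ → Matrix (Fin n) (Fin n) ℝ} {x : ℕ → Fin n → E}
    (hΓ : ∀ j k : ℕ, crossGram (x j) (x k) = Γ ((j : ℤ) - k)) {m : ℕ} (k : ℕ) (hkm : k < m)
    (hdet : ∀ j ≤ k, IsUnit (innovCov Γ j).det) :
    crossGram (x m) (innov Γ x k) = innovCoef Γ m (m - k) * innovCov Γ k := by
  induction k using Nat.strong_induction_on with
  | _ k ih =>
    rw [innov_eq, crossGram_sub_right, hΓ, crossGram_sum_right, innovCoef_eq Γ hkm,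
      Matrix.nonsing_inv_mul_cancel_right _ _ (hdet k le_rfl)]
    congr 1
    refine Finset.sum_congr rfl fun j hj => ?_
    have hj := Finset.mem_range.1 hj
    rw [crossGram_matAct_right, ih j hj (hj.trans hkm) fun i hi => hdet i (hi.trans hj.le)]

/-- Gram-Schmidt orthogonality. Pairing the recursion at step `m` with the innovation `k` leaves
`Θ_{m,m-k} Σ_k` from `x_m` and, by induction, the same term from the subtracted sum. -/
theorem crossGram_innov_innov {n : ℕ} {Γ : ℤ → Matrix (Fin n) (Fin n) ℝ} {x : ℕ → Fin n → E}
    (hΓ : ∀ j k : ℕ, crossGram (x j) (x k) = Γ ((j : ℤ) - k)) (m : ℕ)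
    (hdet : ∀ j < m, IsUnit (innovCov Γ j).det) {k : ℕ} (hkm : k < m) :
    crossGram (innov Γ x m) (innov Γ x k) = 0 := by
  induction m using Nat.strong_induction_on generalizing k with
  | _ m ih =>
    have key : ∀ j k : ℕ, j < m → k < m → j ≠ k →
        crossGram (innov Γ x j) (innov Γ x k) = 0 := by
      intro j k hj hk hjk
      rcases lt_or_gt_of_ne hjk with h | h
      · rw [← crossGram_transpose, ih k hk (fun i hi => hdet i (hi.trans hk)) h,
          Matrix.transpose_zero]
      · exact ih j hj (fun i hi => hdet i (hi.trans hj)) h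
    have hdetk : ∀ j ≤ k, IsUnit (innovCov Γ j).det := fun j hj => hdet j (hj.trans_lt hkm)
    rw [innov_eq Γ x m, crossGram_sub_left, crossGram_sum_left,
      Finset.sum_eq_single_of_mem k (Finset.mem_range.2 hkm), crossGram_matAct_left,
      crossGram_innov hΓ k hkm hdetk, sub_eq_zero]
    · congr 1
      rw [innov_eq Γ x k, crossGram_sub_left]
      have hx : crossGram (x k) (x k - ∑ j ∈ Finset.range k,
          matAct (innovCoef Γ k (k - j)) (innov Γ x j)) = innovCov Γ k := by
        rw [crossGram_sub_right, hΓ, sub_self, crossGram_sum_right, innovCov_eq]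
        congr 1
        refine Finset.sum_congr rfl fun j hj => ?_
        have hj := Finset.mem_range.1 hj
        rw [crossGram_matAct_right, crossGram_innov hΓ j hj fun i hi => hdetk i (hi.trans hj.le)]
      rw [hx, ← innov_eq, crossGram_sum_left, Finset.sum_eq_zero, sub_zero]
      intro j hj
      have hj := Finset.mem_range.1 hj
      rw [crossGram_matAct_left, key j k (hj.trans hkm) hkm hj.ne, Matrix.mul_zero]
    · intro j hj hjk
      rw [crossGram_matAct_left, key j k (Finset.mem_range.1 hj) hkm hjk, Matrix.mul_zero]

/-- The formula for `Σ_m` computes the pairing of `x_m` with its innovation. The remaining part of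
the innovation combines earlier ones, which are orthogonal to it. -/
theorem crossGram_innov_self {n : ℕ} {Γ : ℤ → Matrix (Fin n) (Fin n) ℝ} {x : ℕ → Fin n → E}
    (hΓ : ∀ j k : ℕ, crossGram (x j) (x k) = Γ ((j : ℤ) - k)) (m : ℕ)
    (hdet : ∀ j < m, IsUnit (innovCov Γ j).det) :
    crossGram (innov Γ x m) (innov Γ x m) = innovCov Γ m := by
  have hx : crossGram (x m) (innov Γ x m) = innovCov Γ m := by
    rw [innov_eq, crossGram_sub_right, hΓ, sub_self, crossGram_sum_right, innovCov_eq]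
    congr 1
    refine Finset.sum_congr rfl fun j hj => ?_
    have hj := Finset.mem_range.1 hj
    rw [crossGram_matAct_right,
      crossGram_innov hΓ j hj fun i hi => hdet i (hi.trans_lt hj)]
  nth_rw 1 [innov_eq]
  rw [crossGram_sub_left, hx, crossGram_sum_left, Finset.sum_eq_zero, sub_zero]
  intro j hj
  rw [crossGram_matAct_left, ← crossGram_transpose,
    crossGram_innov_innov hΓ m hdet (Finset.mem_range.1 hj), Matrix.transpose_zero,
    Matrix.mul_zero]

theorem sub_innov_mem {n : ℕ} (Γ : ℤ → Matrix (Fin n) (Fin n) ℝ) (x : ℕ → Fin n → E)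
    (K : Submodule ℝ E) (m : ℕ) (hK : ∀ j < m, ∀ b, x j b ∈ K) (a : Fin n) :
    x m a - innov Γ x m a ∈ K := by
  induction m using Nat.strong_induction_on generalizing a with
  | _ m ih =>
    rw [innov_eq, Pi.sub_apply, sub_sub_cancel, Finset.sum_apply]
    refine K.sum_mem fun j hj => matAct_mem _ _ _ (fun b => ?_) a
    have hj := Finset.mem_range.1 hj
    have h1 := ih j hj (fun i hi => hK i (hi.trans hj)) b
    simpa using K.sub_mem (hK j hj b) h1

/-- The passage from `x` to its innovations is unitriangular, so orthogonality to earlier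
innovations is orthogonality to earlier data. -/
theorem crossGram_innov_eq_zero {n : ℕ} {Γ : ℤ → Matrix (Fin n) (Fin n) ℝ} {x : ℕ → Fin n → E}
    (hΓ : ∀ j k : ℕ, crossGram (x j) (x k) = Γ ((j : ℤ) - k)) (m : ℕ)
    (hdet : ∀ j < m, IsUnit (innovCov Γ j).det) {k : ℕ} (hkm : k < m) :
    crossGram (innov Γ x m) (x k) = 0 := by
  have hx : x k = innov Γ x k
      + ∑ j ∈ Finset.range k, matAct (innovCoef Γ k (k - j)) (innov Γ x j) := by
    rw [innov_eq, sub_add_cancel]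
  rw [hx, crossGram_add_right, crossGram_innov_innov hΓ m hdet hkm, crossGram_sum_right,
    Finset.sum_eq_zero, zero_add]
  intro j hj
  rw [crossGram_matAct_right,
    crossGram_innov_innov hΓ m hdet ((Finset.mem_range.1 hj).trans hkm), Matrix.zero_mul]

/-- If `y` pairs to the identity with `x_m`, is orthogonal to `x_0, …, x_{m-1}` and orthonormal,
the prediction error covariance at step `m` is at least the identity. -/
theorem innovCov_sub_one_posSemidef {n : ℕ} {Γ : ℤ → Matrix (Fin n) (Fin n) ℝ}
    {x y : ℕ → Fin n → E} (hΓ : ∀ j k : ℕ, crossGram (x j) (x k) = Γ ((j : ℤ) - k))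
    (hy : ∀ k, crossGram (y k) (y k) = 1) (hxy : ∀ k, crossGram (x k) (y k) = 1)
    (hpast : ∀ j k, j < k → crossGram (x j) (y k) = 0) (m : ℕ) :
    (innovCov Γ m - 1).PosSemidef := by
  induction m using Nat.strong_induction_on with
  | _ m ih =>
    -- The bound at earlier steps makes the earlier `Σ_j` invertible, which the Gram-Schmidt
    -- identities at step `m` need.
    have hdet : ∀ j < m, IsUnit (innovCov Γ j).det := fun j hj => by
      have := Matrix.PosDef.posSemidef_add (ih j hj) Matrix.PosDef.one
      rw [sub_add_cancel] at this
      exact (Matrix.isUnit_iff_isUnit_det _).1 this.isUnit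
    have hzero : ∀ j < m, crossGram (innov Γ x j) (y m) = 0 := by
      intro j hj
      induction j using Nat.strong_induction_on with
      | _ j ihj =>
        rw [innov_eq, crossGram_sub_left, hpast j m hj, crossGram_sum_left, Finset.sum_eq_zero,
          sub_zero]
        intro i hi
        have hi := Finset.mem_range.1 hi
        rw [crossGram_matAct_left, ihj i hi (hi.trans hj), Matrix.mul_zero]
    have hone : crossGram (innov Γ x m) (y m) = 1 := by
      rw [innov_eq, crossGram_sub_left, hxy, crossGram_sum_left, Finset.sum_eq_zero, sub_zero]
      intro i hi
      rw [crossGram_matAct_left, hzero i (Finset.mem_range.1 hi), Matrix.mul_zero]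
    have hone' : crossGram (y m) (innov Γ x m) = 1 := by
      rw [← crossGram_transpose, hone, Matrix.transpose_one]
    -- This Gram matrix equals `Σ_m - 1 - 1 + 1`.
    have := crossGram_self_posSemidef (innov Γ x m - y m)
    rwa [crossGram_sub_left, crossGram_sub_right, crossGram_sub_right, hone, hone', hy,
      crossGram_innov_self hΓ m hdet, sub_self, sub_zero] at this

end Gram

/-! ### Innovations with respect to the infinite past -/

section Wold

variable {E : Type*} [NormedAddCommGroup E] [InnerProductSpace ℝ E]

theorem tendsto_crossGram {ι : Type*} {l : Filter ι} {m n : ℕ} {x : ι → Fin m → E}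
    {y : ι → Fin n → E} {x₀ : Fin m → E} {y₀ : Fin n → E}
    (hx : ∀ a, Tendsto (fun i => x i a) l (𝓝 (x₀ a)))
    (hy : ∀ b, Tendsto (fun i => y i b) l (𝓝 (y₀ b))) :
    Tendsto (fun i => crossGram (x i) (y i)) l (𝓝 (crossGram x₀ y₀)) :=
  tendsto_pi_nhds.2 fun a => tendsto_pi_nhds.2 fun b => (hx a).inner (hy b)

theorem posSemidef_of_tendsto {ι : Type*} {l : Filter ι} [l.NeBot] {n : ℕ}
    {M : ι → Matrix (Fin n) (Fin n) ℝ} {M₀ : Matrix (Fin n) (Fin n) ℝ}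
    (hM : ∀ i, (M i).PosSemidef) (h : Tendsto M l (𝓝 M₀)) : M₀.PosSemidef := by
  refine Matrix.PosSemidef.of_dotProduct_mulVec_nonneg ?_ fun c => ?_
  · have hc : Continuous fun A : Matrix (Fin n) (Fin n) ℝ => A.conjTranspose :=
      continuous_id.matrix_conjTranspose
    refine tendsto_nhds_unique ((hc.tendsto M₀).comp h) (h.congr fun i => ?_)
    exact (hM i).isHermitian.symm
  · have hc : Continuous fun A : Matrix (Fin n) (Fin n) ℝ => star c ⬝ᵥ A.mulVec c :=
      continuous_const.dotProduct (continuous_id.matrix_mulVec continuous_const)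
    exact ge_of_tendsto' ((hc.tendsto M₀).comp h) fun i => (hM i).dotProduct_mulVec_nonneg c

theorem tendsto_matrix_inv {ι : Type*} {l : Filter ι} {n : ℕ}
    {M : ι → Matrix (Fin n) (Fin n) ℝ} {M₀ : Matrix (Fin n) (Fin n) ℝ}
    (h : Tendsto M l (𝓝 M₀)) (hdet : M₀.det ≠ 0) :
    Tendsto (fun i => (M i)⁻¹) l (𝓝 M₀⁻¹) := by
  simp only [Matrix.inv_def, Ring.inverse_eq_inv']
  have h1 : Continuous fun A : Matrix (Fin n) (Fin n) ℝ => A.det := continuous_id.matrix_det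
  have h2 : Continuous fun A : Matrix (Fin n) (Fin n) ℝ => A.adjugate :=
    continuous_id.matrix_adjugate
  exact (((h1.tendsto M₀).comp h).inv₀ hdet).smul ((h2.tendsto M₀).comp h)

/-- The bound `M ≥ I`, unlike mere positive definiteness, is closed under limits; it is therefore
the form carried for `Σ_n`. -/
theorem posDef_of_sub_one_posSemidef {n : ℕ} {M : Matrix (Fin n) (Fin n) ℝ}
    (h : (M - 1).PosSemidef) : M.PosDef := by
  have := Matrix.PosDef.posSemidef_add h Matrix.PosDef.one
  rwa [sub_add_cancel] at this

theorem isUnit_det_of_posDef {n : ℕ} {M : Matrix (Fin n) (Fin n) ℝ} (h : M.PosDef) :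
    IsUnit M.det :=
  (Matrix.isUnit_iff_isUnit_det _).1 h.isUnit

variable {n : ℕ} {z : ℤ → Fin n → E}

/-- The closed span of the series strictly before time `t`. -/
def pastSpan (z : ℤ → Fin n → E) (t : ℤ) : Submodule ℝ E :=
  (Submodule.span ℝ {v | ∃ s < t, ∃ b, z s b = v}).topologicalClosure

theorem mem_pastSpan (z : ℤ → Fin n → E) {s t : ℤ} (h : s < t) (b : Fin n) :
    z s b ∈ pastSpan z t :=
  Submodule.le_topologicalClosure _ (Submodule.subset_span ⟨s, h, b, rfl⟩)

theorem pastSpan_mono (z : ℤ → Fin n → E) : Monotone (pastSpan z) := fun _ _ h =>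
  Submodule.topologicalClosure_mono <|
    Submodule.span_mono fun _ ⟨u, hu, hb⟩ => ⟨u, hu.trans_le h, hb⟩

/-- Orthogonal complements are closed, so orthogonality need only be checked on the generators. -/
theorem inner_eq_zero_of_mem_pastSpan {t : ℤ} {v x : E}
    (h : ∀ s < t, ∀ b, inner ℝ (z s b) v = 0) (hx : x ∈ pastSpan z t) : inner ℝ x v = 0 := by
  have hle : pastSpan z t ≤ (Submodule.span ℝ {v})ᗮ := by
    refine Submodule.topologicalClosure_minimal _ (Submodule.span_le.2 ?_)
      (Submodule.isClosed_orthogonal _)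
    rintro _ ⟨s, hs, b, rfl⟩
    rw [SetLike.mem_coe, Submodule.mem_orthogonal_singleton_iff_inner_right, real_inner_comm]
    exact h s hs b
  rw [real_inner_comm]
  exact Submodule.mem_orthogonal_singleton_iff_inner_right.1 (hle hx)

/-- The span of the last `N` values strictly before time `t`. -/
def finitePastSpan (z : ℤ → Fin n → E) (t : ℤ) (N : ℕ) : Submodule ℝ E :=
  Submodule.span ℝ (Set.range fun q : Fin N × Fin n => z (t - 1 - (q.1 : ℤ)) q.2)

instance (z : ℤ → Fin n → E) (t : ℤ) (N : ℕ) : FiniteDimensional ℝ (finitePastSpan z t N) :=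
  FiniteDimensional.span_of_finite ℝ (Set.finite_range _)

theorem mem_finitePastSpan (z : ℤ → Fin n → E) {t s : ℤ} {N : ℕ} (h1 : s < t)
    (h2 : t - N ≤ s) (b : Fin n) : z s b ∈ finitePastSpan z t N := by
  refine Submodule.subset_span ⟨(⟨(t - 1 - s).toNat, by omega⟩, b), ?_⟩
  have : t - 1 - (((t - 1 - s).toNat : ℕ) : ℤ) = s := by omega
  simp only [this]

theorem finitePastSpan_mono (z : ℤ → Fin n → E) (t : ℤ) : Monotone (finitePastSpan z t) := by
  intro M N h
  refine Submodule.span_le.2 ?_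
  rintro _ ⟨⟨q, b⟩, rfl⟩
  exact mem_finitePastSpan z (by have := q.isLt; omega) (by have := q.isLt; omega) b

theorem closure_iSup_finitePastSpan (z : ℤ → Fin n → E) (t : ℤ) :
    (⨆ N, finitePastSpan z t N).topologicalClosure = pastSpan z t := by
  rw [pastSpan]
  congr 1
  apply le_antisymm
  · refine iSup_le fun N => Submodule.span_mono ?_
    rintro _ ⟨⟨q, b⟩, rfl⟩
    exact ⟨t - 1 - q, by have := q.isLt; omega, b, rfl⟩
  · refine Submodule.span_le.2 ?_
    rintro _ ⟨s, hs, b, rfl⟩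
    exact (le_iSup (finitePastSpan z t) (t - s).toNat)
      (mem_finitePastSpan z hs (by omega) b)

variable {Γ : ℤ → Matrix (Fin n) (Fin n) ℝ}

/-- The algorithm runs on the window starting at time `t - N`, so that its step `N` predicts `z_t`
from the `N` preceding values. By stationarity every window has the same `Γ`, hence the same
matrices. -/
theorem innov_eq_sub_starProjection (hΓ : ∀ s t, crossGram (z s) (z t) = Γ (s - t))
    (hlow : ∀ n, (innovCov Γ n - 1).PosSemidef) (t : ℤ) (N : ℕ) (a : Fin n) :
    innov Γ (fun k => z (t - N + k)) N a
      = z t a - (finitePastSpan z t N).starProjection (z t a) := by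
  have hdet : ∀ j < N, IsUnit (innovCov Γ j).det := fun j _ =>
    isUnit_det_of_posDef (posDef_of_sub_one_posSemidef (hlow j))
  have hΓ' : ∀ j k : ℕ, crossGram (z (t - N + j)) (z (t - N + k)) = Γ ((j : ℤ) - k) :=
    fun j k => by rw [hΓ]; congr 1; ring
  have ht : z (t - N + N) a = z t a := by rw [sub_add_cancel]
  have hmem := sub_innov_mem Γ (fun k : ℕ => z (t - N + k)) (finitePastSpan z t N) N
    (fun j hj b => mem_finitePastSpan z (by omega) (by omega) b) a
  have := Submodule.eq_starProjection_of_mem_of_inner_eq_zero (K := finitePastSpan z t N)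
    (u := z t a) (v := z t a - innov Γ (fun k => z (t - N + k)) N a) (by rwa [← ht])
    (fun w hw => by
      rw [sub_sub_cancel]
      induction hw using Submodule.span_induction with
      | mem x hx =>
        obtain ⟨⟨q, b⟩, rfl⟩ := hx
        have h1 := crossGram_innov_eq_zero (x := fun k : ℕ => z (t - N + k)) hΓ' N hdet
          (k := N - 1 - q) (by have := q.isLt; omega)
        have h2 := congrFun (congrFun h1 a) b
        have h3 : t - N + ((N - 1 - q : ℕ) : ℤ) = t - 1 - q := by have := q.isLt; omega
        simp only [h3] at h2
        exact h2
      | zero => exact inner_zero_right _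
      | add x y _ _ hx hy => rw [inner_add_right, hx, hy, add_zero]
      | smul c x _ hx => rw [inner_smul_right, hx, mul_zero])
  rw [this, sub_sub_cancel]

theorem exists_coeff_of_mem_finitePastSpan {t : ℤ} {N : ℕ} {x : E}
    (hx : x ∈ finitePastSpan z t N) :
    ∃ c : ℕ → Fin n → ℝ, x = ∑ j ∈ Finset.range N, ∑ b, c j b • z (t - 1 - (j : ℤ)) b := by
  obtain ⟨c, rfl⟩ := (Submodule.mem_span_range_iff_exists_fun ℝ).1 hx
  refine ⟨fun j b => if h : j < N then c (⟨j, h⟩, b) else 0, ?_⟩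
  rw [Fintype.sum_prod_type, Finset.sum_range]
  simp

variable [CompleteSpace E]

instance (z : ℤ → Fin n → E) (t : ℤ) : CompleteSpace (pastSpan z t) :=
  (Submodule.isClosed_topologicalClosure _).completeSpace_coe

/-- The one-step prediction error of `z` given its infinite past. -/
def wold (z : ℤ → Fin n → E) (t : ℤ) : Fin n → E :=
  fun a => z t a - (pastSpan z t).starProjection (z t a)

theorem wold_mem_pastSpan (z : ℤ → Fin n → E) {s t : ℤ} (h : s < t) (a : Fin n) :
    wold z s a ∈ pastSpan z t :=
  Submodule.sub_mem _ (mem_pastSpan z h a)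
    (pastSpan_mono z h.le (Submodule.starProjection_apply_mem _ _))

theorem inner_wold {t : ℤ} {x : E} (hx : x ∈ pastSpan z t) (a : Fin n) :
    inner ℝ x (wold z t a) = 0 := by
  rw [real_inner_comm]
  exact Submodule.starProjection_inner_eq_zero _ _ hx

theorem crossGram_wold_of_lt {s t : ℤ} (h : s < t) : crossGram (wold z s) (wold z t) = 0 := by
  ext a b
  exact inner_wold (wold_mem_pastSpan z h a) b

theorem crossGram_wold_of_ne {s t : ℤ} (h : s ≠ t) : crossGram (wold z s) (wold z t) = 0 := by
  rcases lt_or_gt_of_ne h with h | h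
  · exact crossGram_wold_of_lt h
  · rw [← crossGram_transpose, crossGram_wold_of_lt h, Matrix.transpose_zero]

theorem crossGram_self_wold_of_lt {s t : ℤ} (h : s < t) : crossGram (z s) (wold z t) = 0 := by
  ext a b
  exact inner_wold (mem_pastSpan z h a) b

/-- The finite pasts increase to a dense subspace of the infinite past, so the projections converge
strongly. -/
theorem tendsto_innov (hΓ : ∀ s t, crossGram (z s) (z t) = Γ (s - t))
    (hlow : ∀ n, (innovCov Γ n - 1).PosSemidef) (t : ℤ) (a : Fin n) :
    Tendsto (fun N : ℕ => innov Γ (fun k => z (t - N + k)) N a) atTop (𝓝 (wold z t a)) := by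
  simp only [innov_eq_sub_starProjection hΓ hlow]
  refine tendsto_const_nhds.sub ?_
  have hc : (⨆ N, finitePastSpan z t N).topologicalClosure.HasOrthogonalProjection := by
    rw [closure_iSup_finitePastSpan]
    infer_instance
  have := Submodule.starProjection_tendsto_closure_iSup (finitePastSpan z t)
    (finitePastSpan_mono z t) (z t a)
  simpa only [closure_iSup_finitePastSpan] using this

theorem tendsto_innovCov (hΓ : ∀ s t, crossGram (z s) (z t) = Γ (s - t))
    (hlow : ∀ n, (innovCov Γ n - 1).PosSemidef) (t : ℤ) :
    Tendsto (innovCov Γ) atTop (𝓝 (crossGram (wold z t) (wold z t))) := by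
  refine (tendsto_crossGram (tendsto_innov hΓ hlow t) (tendsto_innov hΓ hlow t)).congr fun N => ?_
  refine crossGram_innov_self (fun j k => ?_) N fun j _ =>
    isUnit_det_of_posDef (posDef_of_sub_one_posSemidef (hlow j))
  rw [hΓ]; congr 1; ring

/-- With the window starting at `t - i - N`, entry `N` is the time `t - i` and entry `N + i` is the
time `t`. The pairing of `z_t` with the finite-past innovation at `t - i` is then `Θ_{N+i,i} Σ_N`.
-/
theorem tendsto_innovCoef_mul (hΓ : ∀ s t, crossGram (z s) (z t) = Γ (s - t))
    (hlow : ∀ n, (innovCov Γ n - 1).PosSemidef) (t : ℤ) {i : ℕ} (hi : 0 < i) :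
    Tendsto (fun N => innovCoef Γ (N + i) i * innovCov Γ N) atTop
      (𝓝 (crossGram (z t) (wold z (t - i)))) := by
  refine (tendsto_crossGram (fun a => tendsto_const_nhds (x := z t a))
    (tendsto_innov hΓ hlow (t - i))).congr fun N => ?_
  have h := crossGram_innov (Γ := Γ) (x := fun k : ℕ => z (t - i - N + k)) (m := N + i)
    (fun j k => by rw [hΓ]; congr 1; ring) N (by omega) fun j _ =>
    isUnit_det_of_posDef (posDef_of_sub_one_posSemidef (hlow j))
  rw [Nat.add_sub_cancel_left] at h
  rw [← h]
  congr 2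
  push_cast
  ring

theorem tendsto_innovCoef (hΓ : ∀ s t, crossGram (z s) (z t) = Γ (s - t))
    (hlow : ∀ n, (innovCov Γ n - 1).PosSemidef) {S : Matrix (Fin n) (Fin n) ℝ}
    (hS : Tendsto (innovCov Γ) atTop (𝓝 S)) (t : ℤ) {i : ℕ} (hi : 0 < i) :
    Tendsto (fun N => innovCoef Γ N i) atTop (𝓝 (crossGram (z t) (wold z (t - i)) * S⁻¹)) := by
  rw [← tendsto_add_atTop_iff_nat i]
  have hS1 : (S - 1).PosSemidef := posSemidef_of_tendsto hlow (hS.sub tendsto_const_nhds)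
  refine ((tendsto_innovCoef_mul hΓ hlow t hi).mul (tendsto_matrix_inv hS
    (isUnit_det_of_posDef (posDef_of_sub_one_posSemidef hS1)).ne_zero)).congr fun N => ?_
  exact Matrix.mul_nonsing_inv_cancel_right _ _
    (isUnit_det_of_posDef (posDef_of_sub_one_posSemidef (hlow N)))

/-- A series whose autocovariances vanish beyond lag `p`, and whose innovations algorithm has
the limits `S` and `Θ`, is the moving average of its prediction errors. -/
theorem eq_wold_add_sum {p : ℕ} (hΓ : ∀ s t, crossGram (z s) (z t) = Γ (s - t))
    (hband : ∀ h : ℤ, (p : ℤ) < h → Γ h = 0)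
    (hlow : ∀ n, (innovCov Γ n - 1).PosSemidef) {S : Matrix (Fin n) (Fin n) ℝ}
    {Θ : ℕ → Matrix (Fin n) (Fin n) ℝ} (hS : Tendsto (innovCov Γ) atTop (𝓝 S))
    (hΘ : ∀ i ∈ Finset.Icc 1 p, Tendsto (fun N => innovCoef Γ N i) atTop (𝓝 (Θ i))) (t : ℤ) :
    z t = wold z t + ∑ i ∈ Finset.Icc 1 p, matAct (Θ i) (wold z (t - i)) := by
  have hS1 : (S - 1).PosSemidef := posSemidef_of_tendsto hlow (hS.sub tendsto_const_nhds)
  have hdet := isUnit_det_of_posDef (posDef_of_sub_one_posSemidef hS1)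
  have hgram : ∀ s, crossGram (wold z s) (wold z s) = S := fun s =>
    tendsto_nhds_unique (tendsto_innovCov hΓ hlow s) hS
  have hcross : ∀ i ∈ Finset.Icc 1 p, crossGram (z t) (wold z (t - i)) = Θ i * S := by
    intro i hi
    rw [tendsto_nhds_unique (hΘ i hi) (tendsto_innovCoef hΓ hlow hS t (Finset.mem_Icc.1 hi).1),
      Matrix.nonsing_inv_mul_cancel_right _ _ hdet]
  -- The remainder lies in the past of `t`; once it is orthogonal to that past, it vanishes.
  set w : Fin n → E := z t - wold z t - ∑ i ∈ Finset.Icc 1 p, matAct (Θ i) (wold z (t - i))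
    with hw
  have hwmem : ∀ a, w a ∈ pastSpan z t := by
    intro a
    rw [hw, Pi.sub_apply, Finset.sum_apply]
    refine Submodule.sub_mem _ ?_ (Submodule.sum_mem _ fun i hi => matAct_mem _ _ _ (fun b => ?_) a)
    · rw [Pi.sub_apply, wold, sub_sub_cancel]
      exact Submodule.starProjection_apply_mem _ _
    · exact wold_mem_pastSpan z (by have := (Finset.mem_Icc.1 hi).1; omega) b
  have horth : ∀ m : ℕ, m ≤ p → ∀ s < t - p + m, crossGram (z s) w = 0 := by
    intro m
    induction m with
    | zero =>
      intro _ s hs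
      rw [hw, crossGram_sub_right, crossGram_sub_right, ← crossGram_transpose (z t), hΓ,
        hband _ (by push_cast at hs; omega), Matrix.transpose_zero,
        crossGram_self_wold_of_lt (by push_cast at hs; omega),
        crossGram_sum_right, Finset.sum_eq_zero, sub_zero, sub_zero]
      intro i hi
      have := (Finset.mem_Icc.1 hi).2
      rw [crossGram_matAct_right, crossGram_self_wold_of_lt (by push_cast at hs; omega),
        Matrix.zero_mul]
    | succ m ih =>
      intro hm s hs
      rcases lt_or_ge s (t - p + m) with h | h
      · exact ih (by omega) s h
      · obtain rfl : s = t - ((p - m : ℕ) : ℤ) := by push_cast at hs; omega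
        have hi : p - m ∈ Finset.Icc 1 p := Finset.mem_Icc.2 ⟨by omega, by omega⟩
        -- At the new time, `z` splits into its prediction error and a vector of its own past. The
        -- error is orthogonal to `w` because `Θ_i S` is the covariance of `z_t` with the error at
        -- lag `i`; the other part is covered by the induction hypothesis.
        have hwold : crossGram (wold z (t - ((p - m : ℕ) : ℤ))) w = 0 := by
          have hpos : t - ((p - m : ℕ) : ℤ) < t := by omega
          rw [hw, crossGram_sub_right, crossGram_sub_right, ← crossGram_transpose (z t),
            hcross _ hi, crossGram_wold_of_lt hpos, crossGram_sum_right,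
            Finset.sum_eq_single_of_mem _ hi, crossGram_matAct_right, hgram, Matrix.transpose_mul,
            ← hgram 0, crossGram_transpose, sub_zero, sub_self]
          intro j _ hj
          rw [crossGram_matAct_right, crossGram_wold_of_ne (by omega), Matrix.zero_mul]
        ext a b
        have hz : z (t - ((p - m : ℕ) : ℤ)) a = wold z (t - ((p - m : ℕ) : ℤ)) a
            + (pastSpan z (t - ((p - m : ℕ) : ℤ))).starProjection
              (z (t - ((p - m : ℕ) : ℤ)) a) := by simp [wold]
        rw [crossGram_apply, hz, inner_add_left, ← crossGram_apply, hwold, Matrix.zero_apply,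
          zero_add]
        refine inner_eq_zero_of_mem_pastSpan (t := t - ((p - m : ℕ) : ℤ)) (fun u hu c => ?_)
          (Submodule.starProjection_apply_mem _ _)
        rw [← crossGram_apply, ih (by omega) u (by omega), Matrix.zero_apply]
  have hzero : w = 0 := by
    funext a
    have := inner_eq_zero_of_mem_pastSpan (v := w a) (fun s hs b => by
      rw [← crossGram_apply, horth p le_rfl s (by omega), Matrix.zero_apply]) (hwmem a)
    exact inner_self_eq_zero.1 this
  rw [hw, sub_sub, sub_eq_zero] at hzero
  exact hzero

/-- The prediction errors are limits of finite linear combinations of the present and past. -/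
theorem exists_filter_near_wold (hΓ : ∀ s t, crossGram (z s) (z t) = Γ (s - t))
    (hlow : ∀ n, (innovCov Γ n - 1).PosSemidef) (t : ℤ) {δ : ℝ} (hδ : 0 < δ) :
    ∃ (N : ℕ) (A : ℕ → Matrix (Fin n) (Fin n) ℝ), ∀ a,
      ‖wold z t a - (∑ j ∈ Finset.range N, matAct (A j) (z (t - (j : ℤ)))) a‖ < δ := by
  have h : ∀ᶠ N : ℕ in atTop, ∀ a, ‖wold z t a - innov Γ (fun k => z (t - N + k)) N a‖ < δ := by
    rw [eventually_all]
    intro a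
    have := (tendsto_innov hΓ hlow t a).const_sub (wold z t a)
    rw [sub_self] at this
    exact (this.norm.eventually_lt_const (by simpa using hδ))
  obtain ⟨N, hN⟩ := h.exists
  -- The innovation involves `z_t` itself, hence the `N + 1` values strictly before `t + 1`.
  have hmem : ∀ a, innov Γ (fun k => z (t - N + k)) N a ∈ finitePastSpan z (t + 1) (N + 1) := by
    intro a
    rw [innov_eq_sub_starProjection hΓ hlow]
    refine Submodule.sub_mem _ (mem_finitePastSpan z (by omega) (by push_cast; omega) a) ?_
    refine Submodule.span_mono ?_ (Submodule.starProjection_apply_mem (finitePastSpan z t N) _)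
    rintro _ ⟨⟨q, b⟩, rfl⟩
    refine ⟨(⟨q + 1, by omega⟩, b), ?_⟩
    simp only
    congr 1
    push_cast
    ring
  choose c hc using fun a => exists_coeff_of_mem_finitePastSpan (hmem a)
  refine ⟨N + 1, fun j => Matrix.of fun a b => c a j b, fun a => ?_⟩
  convert! hN a using 3
  rw [hc a, Finset.sum_apply]
  simp [matAct]

end Wold

/-! ### Autocovariances of moving averages -/

section MovingAverage

theorem sum_range_succ_eq_add_sum_Icc {M : Type*} [AddCommMonoid M] (f : ℕ → M) (p : ℕ) :
    ∑ i ∈ Finset.range (p + 1), f i = f 0 + ∑ i ∈ Finset.Icc 1 p, f i := by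
  rw [Finset.range_eq_Ico, Finset.sum_eq_sum_Ico_succ_bot (Nat.succ_pos p), zero_add,
    Nat.succ_eq_add_one, Finset.Ico_add_one_right_eq_Icc]

theorem withZeroth_zero {n : ℕ} (A₀ : Matrix (Fin n) (Fin n) ℝ)
    (A : ℕ → Matrix (Fin n) (Fin n) ℝ) : withZeroth A₀ A 0 = A₀ := rfl

theorem withZeroth_of_pos {n : ℕ} (A₀ : Matrix (Fin n) (Fin n) ℝ)
    (A : ℕ → Matrix (Fin n) (Fin n) ℝ) {i : ℕ} (hi : 0 < i) : withZeroth A₀ A i = A i :=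
  if_neg hi.ne'

theorem withZeroth_neg {n : ℕ} (A₀ : Matrix (Fin n) (Fin n) ℝ)
    (A : ℕ → Matrix (Fin n) (Fin n) ℝ) (i : ℕ) :
    withZeroth (-A₀) A i = -withZeroth A₀ (fun i => -A i) i := by
  unfold withZeroth
  split_ifs <;> simp

theorem sum_withZeroth {n : ℕ} {M : Type*} [AddCommMonoid M] (A₀ : Matrix (Fin n) (Fin n) ℝ)
    (A : ℕ → Matrix (Fin n) (Fin n) ℝ) (f : ℕ → Matrix (Fin n) (Fin n) ℝ → M) (p : ℕ) :
    ∑ i ∈ Finset.range (p + 1), f i (withZeroth A₀ A i)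
      = f 0 A₀ + ∑ i ∈ Finset.Icc 1 p, f i (A i) := by
  rw [sum_range_succ_eq_add_sum_Icc, withZeroth_zero]
  congr 1
  exact Finset.sum_congr rfl fun i hi => by rw [withZeroth_of_pos _ _ (Finset.mem_Icc.1 hi).1]

/-- The autocovariance function of a moving average with coefficients `B_0, …, B_p` and error
covariance `S`. -/
def bandCov {n : ℕ} (p : ℕ) (B : ℕ → Matrix (Fin n) (Fin n) ℝ) (S : Matrix (Fin n) (Fin n) ℝ)
    (h : ℤ) : Matrix (Fin n) (Fin n) ℝ :=
  ∑ i ∈ Finset.range (p + 1), ∑ j ∈ Finset.range (p + 1),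
    if (i : ℤ) - j = h then B i * S * (B j).transpose else 0

variable {n p : ℕ}

theorem bandCov_natCast (B : ℕ → Matrix (Fin n) (Fin n) ℝ) (S : Matrix (Fin n) (Fin n) ℝ)
    {h : ℕ} (hp : h ≤ p) :
    bandCov p B S h
      = ∑ i ∈ Finset.range (p - h + 1), B (i + h) * S * (B i).transpose := by
  rw [bandCov, Finset.sum_comm]
  have hsub : Finset.range (p - h + 1) ⊆ Finset.range (p + 1) :=
    Finset.range_subset_range.2 (by omega)
  rw [← Finset.sum_subset hsub]
  · refine Finset.sum_congr rfl fun j hj => ?_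
    have hj := Finset.mem_range.1 hj
    rw [Finset.sum_eq_single_of_mem (j + h) (Finset.mem_range.2 (by omega)), if_pos (by omega)]
    exact fun i _ hi => if_neg (by omega)
  · intro j _ hj
    have hj : p - h + 1 ≤ j := by simpa using hj
    exact Finset.sum_eq_zero fun i hi => if_neg (by have := Finset.mem_range.1 hi; omega)

theorem bandCov_neg (B : ℕ → Matrix (Fin n) (Fin n) ℝ) {S : Matrix (Fin n) (Fin n) ℝ}
    (hS : S.IsSymm) (h : ℤ) : bandCov p B S (-h) = (bandCov p B S h).transpose := by
  rw [bandCov, bandCov, Finset.sum_comm, Matrix.transpose_sum]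
  refine Finset.sum_congr rfl fun i _ => ?_
  rw [Matrix.transpose_sum]
  refine Finset.sum_congr rfl fun j _ => ?_
  by_cases hij : (i : ℤ) - j = h
  · rw [if_pos hij, if_pos (by omega)]
    simp [Matrix.transpose_mul, hS.eq, Matrix.mul_assoc]
  · rw [if_neg hij, if_neg (by omega), Matrix.transpose_zero]

theorem bandCov_eq_zero (B : ℕ → Matrix (Fin n) (Fin n) ℝ) (S : Matrix (Fin n) (Fin n) ℝ)
    {h : ℤ} (hp : (p : ℤ) < h) : bandCov p B S h = 0 :=
  Finset.sum_eq_zero fun i hi => Finset.sum_eq_zero fun j _ =>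
    if_neg (by have := Finset.mem_range.1 hi; omega)

theorem bandCov_withZeroth_zero (Θ : ℕ → Matrix (Fin n) (Fin n) ℝ)
    (S : Matrix (Fin n) (Fin n) ℝ) :
    bandCov p (withZeroth 1 Θ) S 0 = S + ∑ i ∈ Finset.Icc 1 p, Θ i * S * (Θ i).transpose := by
  have := bandCov_natCast (p := p) (withZeroth 1 Θ) S (Nat.zero_le p)
  rw [Nat.cast_zero] at this
  rw [this, Nat.sub_zero]
  simp only [add_zero]
  rw [sum_withZeroth (M := Matrix (Fin n) (Fin n) ℝ) 1 Θ fun _ M => M * S * M.transpose]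
  simp

theorem solvesVMASystem_of_eq_bandCov {Γ : ℤ → Matrix (Fin n) (Fin n) ℝ}
    {S : Matrix (Fin n) (Fin n) ℝ} {Θ : ℕ → Matrix (Fin n) (Fin n) ℝ} (hS : S.IsSymm)
    (h : ∀ h, Γ h = bandCov p (withZeroth 1 Θ) S h) : SolvesVMASystem p Γ S Θ where
  symmetric := hS
  lag_zero := by rw [h, bandCov_withZeroth_zero]
  lag_pos k hk := by rw [h, bandCov_natCast _ _ (Finset.mem_Icc.1 hk).2]

/-- The system constrains lags `0` to `p` only; the band condition supplies larger lags and
transposition the negative ones. -/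
theorem SolvesVMASystem.eq_bandCov {Γ : ℤ → Matrix (Fin n) (Fin n) ℝ}
    {S : Matrix (Fin n) (Fin n) ℝ} {Θ : ℕ → Matrix (Fin n) (Fin n) ℝ}
    (hsol : SolvesVMASystem p Γ S Θ) (hneg : ∀ h, Γ (-h) = (Γ h).transpose)
    (hband : ∀ h : ℤ, (p : ℤ) < h → Γ h = 0) (h : ℤ) :
    Γ h = bandCov p (withZeroth 1 Θ) S h := by
  have hnat : ∀ k : ℕ, Γ k = bandCov p (withZeroth 1 Θ) S k := by
    intro k
    rcases Nat.eq_zero_or_pos k with rfl | hk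
    · rw [Nat.cast_zero, bandCov_withZeroth_zero, hsol.lag_zero]
    · rcases le_or_gt k p with hkp | hkp
      · rw [bandCov_natCast _ _ hkp, hsol.lag_pos k (Finset.mem_Icc.2 ⟨hk, hkp⟩)]
      · rw [hband _ (by omega), bandCov_eq_zero _ _ (by omega)]
  rcases le_total 0 h with h0 | h0
  · obtain ⟨k, rfl⟩ := Int.eq_ofNat_of_zero_le h0
    exact hnat k
  · obtain ⟨k, hk⟩ := Int.eq_ofNat_of_zero_le (neg_nonneg.2 h0)
    obtain rfl : h = -(k : ℤ) := by omega
    rw [hneg, hnat, bandCov_neg _ hsol.symmetric]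

variable {E : Type*} [NormedAddCommGroup E] [InnerProductSpace ℝ E]

/-- The moving average `∑_{i=0}^p B_i x_{t-i}`. -/
def movingAverage (p : ℕ) (B : ℕ → Matrix (Fin n) (Fin n) ℝ) (x : ℤ → Fin n → E) (t : ℤ) :
    Fin n → E :=
  ∑ i ∈ Finset.range (p + 1), matAct (B i) (x (t - i))

theorem movingAverage_withZeroth (Θ : ℕ → Matrix (Fin n) (Fin n) ℝ) (x : ℤ → Fin n → E) (t : ℤ) :
    movingAverage p (withZeroth 1 Θ) x t
      = x t + ∑ i ∈ Finset.Icc 1 p, matAct (Θ i) (x (t - i)) := by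
  rw [movingAverage, sum_withZeroth 1 Θ fun i M => matAct M (x (t - i)), matAct_one, Nat.cast_zero,
    sub_zero]

theorem crossGram_movingAverage {x : ℤ → Fin n → E} {S : Matrix (Fin n) (Fin n) ℝ}
    (hx : ∀ s t, crossGram (x s) (x t) = if s = t then S else 0)
    (B : ℕ → Matrix (Fin n) (Fin n) ℝ) (s t : ℤ) :
    crossGram (movingAverage p B x s) (movingAverage p B x t) = bandCov p B S (s - t) := by
  rw [movingAverage, movingAverage, crossGram_sum_left, bandCov]
  refine Finset.sum_congr rfl fun i _ => ?_
  rw [crossGram_sum_right]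
  refine Finset.sum_congr rfl fun j _ => ?_
  rw [crossGram_matAct_left, crossGram_matAct_right, hx]
  by_cases h : s - i = t - j
  · rw [if_pos h, if_pos (by omega), Matrix.mul_assoc]
  · rw [if_neg h, if_neg (by omega), Matrix.zero_mul, Matrix.mul_zero]

theorem crossGram_movingAverage_left {x : ℤ → Fin n → E} {S : Matrix (Fin n) (Fin n) ℝ}
    (hx : ∀ s t, crossGram (x s) (x t) = if s = t then S else 0)
    (B : ℕ → Matrix (Fin n) (Fin n) ℝ) (t : ℤ) {i : ℕ} (hi : i ≤ p) :
    crossGram (movingAverage p B x t) (x (t - i)) = B i * S := by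
  rw [movingAverage, crossGram_sum_left,
    Finset.sum_eq_single_of_mem i (Finset.mem_range.2 (by omega)), crossGram_matAct_left, hx,
    if_pos rfl]
  intro j _ hj
  rw [crossGram_matAct_left, hx, if_neg (by omega), Matrix.mul_zero]

theorem crossGram_movingAverage_of_lt {x : ℤ → Fin n → E} {S : Matrix (Fin n) (Fin n) ℝ}
    (hx : ∀ s t, crossGram (x s) (x t) = if s = t then S else 0)
    (B : ℕ → Matrix (Fin n) (Fin n) ℝ) {s t : ℤ} (hst : s < t) :
    crossGram (movingAverage p B x s) (x t) = 0 := by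
  rw [movingAverage, crossGram_sum_left, Finset.sum_eq_zero]
  intro j _
  rw [crossGram_matAct_left, hx, if_neg (by omega), Matrix.mul_zero]

/-- The innovations algorithm gives the maximal error covariance among all moving average
representations of the autocovariance function. -/
theorem maximal_of_tendsto [CompleteSpace E] {Γ : ℤ → Matrix (Fin n) (Fin n) ℝ}
    (hlow : ∀ n, (innovCov Γ n - 1).PosSemidef) {S S' : Matrix (Fin n) (Fin n) ℝ}
    {Θ Θ' : ℕ → Matrix (Fin n) (Fin n) ℝ} (hS : Tendsto (innovCov Γ) atTop (𝓝 S))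
    (hΘ : ∀ i ∈ Finset.Icc 1 p, Tendsto (fun N => innovCoef Γ N i) atTop (𝓝 (Θ i)))
    {x : ℤ → Fin n → E} (hx : ∀ s t, crossGram (x s) (x t) = if s = t then S' else 0)
    (hΓ : ∀ h, Γ h = bandCov p (withZeroth 1 Θ') S' h) :
    (S - S').PosSemidef ∧ (S' = S → ∀ i ∈ Finset.Icc 1 p, Θ' i = Θ i) := by
  -- A new series with the given autocovariances. The algorithm sees only `Γ`, so its limits
  -- describe the prediction errors of this series too.
  set z : ℤ → Fin n → E := movingAverage p (withZeroth 1 Θ') x with hz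
  have hzΓ : ∀ s t, crossGram (z s) (z t) = Γ (s - t) := fun s t => by
    rw [hΓ, hz, crossGram_movingAverage hx]
  have hgram : ∀ s, crossGram (wold z s) (wold z s) = S := fun s =>
    tendsto_nhds_unique (tendsto_innovCov hzΓ hlow s) hS
  -- The noise at time `t` is orthogonal to the past of `z`, so the prediction part of `z_t`
  -- contributes nothing.
  have hcross : ∀ t, crossGram (wold z t) (x t) = S' := by
    intro t
    have h0 : crossGram (z t) (x t) = S' := by
      have := crossGram_movingAverage_left hx (withZeroth 1 Θ') t (Nat.zero_le p)
      rwa [Nat.cast_zero, sub_zero, withZeroth_zero, Matrix.one_mul] at this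
    rw [← h0]
    ext a b
    rw [crossGram_apply, crossGram_apply, wold, inner_sub_left, sub_eq_self]
    refine inner_eq_zero_of_mem_pastSpan (fun s hs c => ?_)
      (Submodule.starProjection_apply_mem (pastSpan z t) _)
    rw [← crossGram_apply, hz, crossGram_movingAverage_of_lt hx _ hs, Matrix.zero_apply]
  have hsymm : S'.transpose = S' := by
    have := crossGram_transpose (x 0) (x 0)
    rwa [hx, if_pos rfl] at this
  have hcross' : ∀ t, crossGram (x t) (wold z t) = S' := fun t => by
    rw [← crossGram_transpose, hcross, hsymm]
  have hdiff : ∀ t, crossGram (wold z t - x t) (wold z t - x t) = S - S' := by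
    intro t
    rw [crossGram_sub_left, crossGram_sub_right, crossGram_sub_right, hgram, hcross, hcross', hx,
      if_pos rfl, sub_self, sub_zero]
  refine ⟨hdiff 0 ▸ crossGram_self_posSemidef _, ?_⟩
  rintro rfl i hi
  have hwx : ∀ t, wold z t = x t := fun t =>
    eq_of_crossGram_sub_eq_zero (by rw [hdiff, sub_self])
  have hS1 : (S' - 1).PosSemidef := posSemidef_of_tendsto hlow (hS.sub tendsto_const_nhds)
  have hdet := isUnit_det_of_posDef (posDef_of_sub_one_posSemidef hS1)
  obtain ⟨hi1, hip⟩ := Finset.mem_Icc.1 hi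
  rw [tendsto_nhds_unique (hΘ i hi) (tendsto_innovCoef hzΓ hlow hS 0 hi1), hwx, hz,
    crossGram_movingAverage_left hx _ _ hip, withZeroth_of_pos _ _ hi1,
    Matrix.mul_nonsing_inv_cancel_right _ _ hdet]

end MovingAverage

/-! ### The spectral density on the unit circle -/

section Spectral

open scoped ComplexOrder

variable {n p : ℕ}

/-- A real matrix as a complex one. -/
def toComplex {m n : ℕ} (M : Matrix (Fin m) (Fin n) ℝ) : Matrix (Fin m) (Fin n) ℂ :=
  M.map fun x : ℝ => (x : ℂ)

theorem toComplex_mul {l m n : ℕ} (M : Matrix (Fin l) (Fin m) ℝ) (N : Matrix (Fin m) (Fin n) ℝ) :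
    toComplex (M * N) = toComplex M * toComplex N := by
  ext a b
  simp [toComplex, Matrix.mul_apply]

theorem toComplex_add {m n : ℕ} (M N : Matrix (Fin m) (Fin n) ℝ) :
    toComplex (M + N) = toComplex M + toComplex N := by
  ext a b
  simp [toComplex]

theorem toComplex_smul {m n : ℕ} (c : ℝ) (M : Matrix (Fin m) (Fin n) ℝ) :
    toComplex (c • M) = (c : ℂ) • toComplex M := by
  ext a b
  simp [toComplex]

theorem toComplex_zero {m n : ℕ} : toComplex (0 : Matrix (Fin m) (Fin n) ℝ) = 0 := by
  ext a b
  simp [toComplex]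

theorem toComplex_one : toComplex (1 : Matrix (Fin n) (Fin n) ℝ) = 1 := by
  ext a b
  simp [toComplex, Matrix.one_apply, apply_ite]

theorem toComplex_sum {ι : Type*} {m n : ℕ} (s : Finset ι) (M : ι → Matrix (Fin m) (Fin n) ℝ) :
    toComplex (∑ i ∈ s, M i) = ∑ i ∈ s, toComplex (M i) := by
  ext a b
  simp [toComplex, Matrix.sum_apply]

theorem conjTranspose_toComplex {m n : ℕ} (M : Matrix (Fin m) (Fin n) ℝ) :
    (toComplex M).conjTranspose = toComplex M.transpose := by
  ext a b
  simp [toComplex]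

theorem Matrix.PosSemidef.exists_eq_transpose_mul {M : Matrix (Fin n) (Fin n) ℝ}
    (hM : M.PosSemidef) : ∃ B : Matrix (Fin n) (Fin n) ℝ, M = B.transpose * B := by
  open scoped MatrixOrder in
  obtain ⟨B, hB⟩ := CStarAlgebra.nonneg_iff_eq_star_mul_self.mp hM.nonneg
  exact ⟨B, by rw [hB, Matrix.star_eq_conjTranspose, Matrix.conjTranspose_eq_transpose_of_trivial]⟩

theorem Matrix.PosSemidef.toComplex {M : Matrix (Fin n) (Fin n) ℝ} (hM : M.PosSemidef) :
    (toComplex M).PosSemidef := by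
  obtain ⟨B, rfl⟩ := hM.exists_eq_transpose_mul
  rw [toComplex_mul, ← conjTranspose_toComplex]
  exact Matrix.posSemidef_conjTranspose_mul_self _

theorem matrixPoly_eq_sum (A : ℕ → Matrix (Fin n) (Fin n) ℝ) (z : ℂ) :
    matrixPoly p A z
      = ∑ i ∈ Finset.range (p + 1), z ^ i • toComplex (withZeroth 1 A i) := by
  rw [sum_withZeroth 1 A fun i M => z ^ i • toComplex M, toComplex_one, pow_zero, one_smul]
  rfl

/-- On the circle the conjugate of `z` is its inverse, so the product `B(z) S B(z)*` collects the
terms `(i, j)` by the power `i - j`. -/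
theorem sum_zpow_smul_bandCov (B : ℕ → Matrix (Fin n) (Fin n) ℝ) (S : Matrix (Fin n) (Fin n) ℝ)
    {z : ℂ} (hz : ‖z‖ = 1) :
    ∑ h ∈ Finset.Icc (-(p : ℤ)) p, z ^ h • toComplex (bandCov p B S h)
      = (∑ i ∈ Finset.range (p + 1), z ^ i • toComplex (B i)) * toComplex S
        * (∑ i ∈ Finset.range (p + 1), z ^ i • toComplex (B i)).conjTranspose := by
  have hz0 : z ≠ 0 := by rintro rfl; simp at hz
  have hconj : star z = z⁻¹ := by
    rw [Complex.star_def, Complex.inv_def, Complex.normSq_eq_norm_sq, hz]; simp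
  simp only [bandCov, toComplex_sum, Finset.smul_sum]
  rw [Finset.sum_comm, Matrix.conjTranspose_sum, Finset.sum_mul, Finset.sum_mul]
  refine Finset.sum_congr rfl fun i hi => ?_
  rw [Finset.sum_comm, Finset.mul_sum]
  refine Finset.sum_congr rfl fun j hj => ?_
  have hi := Finset.mem_range.1 hi
  have hj := Finset.mem_range.1 hj
  rw [Finset.sum_eq_single_of_mem ((i : ℤ) - j) (Finset.mem_Icc.2 ⟨by omega, by omega⟩),
    if_pos rfl, Matrix.conjTranspose_smul, conjTranspose_toComplex, star_pow, hconj,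
    toComplex_mul, toComplex_mul, zpow_sub₀ hz0, zpow_natCast, zpow_natCast, div_eq_mul_inv,
    inv_pow]
  · simp [smul_smul, mul_comm]
  · intro h _ hne
    rw [if_neg (Ne.symm hne), toComplex_zero, smul_zero]

variable {A Θ : ℕ → Matrix (Fin n) (Fin n) ℝ} {R S : Matrix (Fin n) (Fin n) ℝ}

theorem spectral_factorization
    (h : ∀ h : ℤ, (if h = 0 then R else 0) + bandCov p (withZeroth 1 A) 1 h
      = bandCov p (withZeroth 1 Θ) S h) {z : ℂ} (hz : ‖z‖ = 1) :
    matrixPoly p Θ z * toComplex S * (matrixPoly p Θ z).conjTranspose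
      = toComplex R + matrixPoly p A z * (matrixPoly p A z).conjTranspose := by
  have h1 := sum_zpow_smul_bandCov (p := p) (withZeroth 1 Θ) S hz
  have h2 := sum_zpow_smul_bandCov (p := p) (withZeroth 1 A) 1 hz
  rw [← matrixPoly_eq_sum] at h1 h2
  rw [← h1]
  rw [toComplex_one, Matrix.mul_one] at h2
  rw [← h2]
  simp only [← h, toComplex_add, smul_add, Finset.sum_add_distrib]
  congr 1
  rw [Finset.sum_eq_single_of_mem 0 (Finset.mem_Icc.2 ⟨by omega, by omega⟩)]
  · simp
  · intro k _ hk
    rw [if_neg hk, toComplex_zero, smul_zero]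

/-- The form is a sum of two nonnegative forms, so if it is at most zero both vanish, and so do the
vectors they measure. -/
theorem mulVec_eq_zero_of_spectral (hR : R.PosSemidef)
    (h : ∀ h : ℤ, (if h = 0 then R else 0) + bandCov p (withZeroth 1 A) 1 h
      = bandCov p (withZeroth 1 Θ) S h) {z : ℂ} (hz : ‖z‖ = 1) {y : Fin n → ℂ}
    (hy : star y ⬝ᵥ ((matrixPoly p Θ z * toComplex S
      * (matrixPoly p Θ z).conjTranspose).mulVec y) ≤ 0) :
    (toComplex R).mulVec y = 0 ∧ (matrixPoly p A z).conjTranspose.mulVec y = 0 := by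
  rw [spectral_factorization h hz, Matrix.add_mulVec, dotProduct_add] at hy
  have h1 := hR.toComplex.dotProduct_mulVec_nonneg y
  have hAA := Matrix.posSemidef_self_mul_conjTranspose (matrixPoly p A z)
  have h2 := hAA.dotProduct_mulVec_nonneg y
  have e1 := le_antisymm ((le_add_of_nonneg_right h2).trans hy) h1
  have e2 := le_antisymm ((le_add_of_nonneg_left h1).trans hy) h2
  refine ⟨(hR.toComplex.dotProduct_mulVec_zero_iff y).1 e1, ?_⟩
  have e3 : star ((matrixPoly p A z).conjTranspose.mulVec y)
      = Matrix.vecMul (star y) (matrixPoly p A z) := by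
    rw [Matrix.star_mulVec, Matrix.conjTranspose_conjTranspose]
  rw [← Matrix.mulVec_mulVec, Matrix.dotProduct_mulVec, ← e3] at e2
  exact dotProduct_star_self_eq_zero.1 e2

/-- The matrix `I + ∑_{i=1}^p A_i X^i` with polynomial entries. -/
def matrixPolyMatrix (p : ℕ) (A : ℕ → Matrix (Fin n) (Fin n) ℝ) :
    Matrix (Fin n) (Fin n) (Polynomial ℝ) :=
  1 + ∑ i ∈ Finset.Icc 1 p, (Polynomial.X : Polynomial ℝ) ^ i • (A i).map Polynomial.C

theorem aeval_det_matrixPolyMatrix (A : ℕ → Matrix (Fin n) (Fin n) ℝ) (z : ℂ) :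
    Polynomial.aeval z (matrixPolyMatrix p A).det = (matrixPoly p A z).det := by
  rw [AlgHom.map_det]
  congr 1
  ext a b
  simp [matrixPolyMatrix, matrixPoly, Matrix.sum_apply, Matrix.one_apply, apply_ite]
  exact Finset.sum_congr rfl fun _ _ => mul_comm _ _

theorem det_matrixPolyMatrix_ne_zero (A : ℕ → Matrix (Fin n) (Fin n) ℝ) :
    (matrixPolyMatrix p A).det ≠ 0 := by
  intro h
  have := aeval_det_matrixPolyMatrix (p := p) A 0
  have h1 : matrixPoly p A 0 = 1 := by
    rw [matrixPoly, Finset.sum_eq_zero, add_zero]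
    intro i hi
    rw [zero_pow (by have := (Finset.mem_Icc.1 hi).1; omega), zero_smul]
  rw [h, h1] at this
  simp at this

/-- The determinant is a nonzero polynomial in `z`, equal to one at the origin, and the circle is
infinite. -/
theorem exists_norm_eq_one_det_ne_zero (A : ℕ → Matrix (Fin n) (Fin n) ℝ) :
    ∃ z : ℂ, ‖z‖ = 1 ∧ (matrixPoly p A z).det ≠ 0 := by
  have hinf : (Metric.sphere (0 : ℂ) 1).Infinite := by
    refine (isPreconnected_sphere (by simp) _ _).infinite_of_nontrivial ⟨1, by simp, -1, by simp, ?_⟩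
    intro h
    have := congrArg Complex.re h
    norm_num at this
  have hfin : {z : ℂ | Polynomial.aeval z (matrixPolyMatrix p A).det = 0}.Finite := by
    refine ((matrixPolyMatrix p A).det.rootSet_finite ℂ).subset fun z hz => ?_
    exact (Polynomial.mem_rootSet).2 ⟨det_matrixPolyMatrix_ne_zero A, hz⟩
  obtain ⟨z, hz, hz'⟩ := (hinf.sdiff hfin).nonempty
  exact ⟨z, by simpa using hz, fun h => hz' (by simpa [aeval_det_matrixPolyMatrix] using h)⟩

theorem isUnit_of_mulVec_eq_zero {K : Type*} [Field K] {M : Matrix (Fin n) (Fin n) K}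
    (h : ∀ y, M.mulVec y = 0 → y = 0) : IsUnit M := by
  rw [← Matrix.mulVec_injective_iff_isUnit]
  exact (injective_iff_map_eq_zero M.mulVecLin).2 h

/-- A symmetric error covariance of a moving average with spectral density at least `A(z)A(z)^*`
is positive definite. -/
theorem posDef_of_spectral (hR : R.PosSemidef) (hS : S.IsSymm)
    (h : ∀ h : ℤ, (if h = 0 then R else 0) + bandCov p (withZeroth 1 A) 1 h
      = bandCov p (withZeroth 1 Θ) S h) : S.PosDef := by
  obtain ⟨z, hz, hdet⟩ := exists_norm_eq_one_det_ne_zero (p := p) A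
  have hAu : IsUnit (matrixPoly p A z).conjTranspose := by
    rw [Matrix.isUnit_iff_isUnit_det, Matrix.det_conjTranspose]
    exact (isUnit_iff_ne_zero.2 hdet).star
  have key : ∀ y : Fin n → ℂ, star y ⬝ᵥ ((matrixPoly p Θ z * toComplex S
      * (matrixPoly p Θ z).conjTranspose).mulVec y) ≤ 0 → y = 0 := fun y hy =>
    Matrix.mulVec_injective_of_isUnit hAu
      ((mulVec_eq_zero_of_spectral hR h hz hy).2.trans (Matrix.mulVec_zero _).symm)
  have hΘu : IsUnit (matrixPoly p Θ z).conjTranspose := by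
    refine isUnit_of_mulVec_eq_zero fun y hy => ?_
    refine key y (le_of_eq ?_)
    rw [← Matrix.mulVec_mulVec, hy, Matrix.mulVec_zero, dotProduct_zero]
  refine Matrix.PosDef.of_dotProduct_mulVec_pos ?_ fun x hx => ?_
  · rwa [Matrix.IsHermitian, Matrix.conjTranspose_eq_transpose_of_trivial]
  -- Solving `Θ(z)* y = x` turns the complex form at `y` into the real form `x'Sx`.
  obtain ⟨y, hy⟩ := Matrix.mulVec_surjective_iff_isUnit.2 hΘu (fun a => (x a : ℂ))
  have hval : star y ⬝ᵥ ((matrixPoly p Θ z * toComplex S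
      * (matrixPoly p Θ z).conjTranspose).mulVec y)
      = ((star x ⬝ᵥ S.mulVec x : ℝ) : ℂ) := by
    have e3 : star (fun a => (x a : ℂ)) = Matrix.vecMul (star y) (matrixPoly p Θ z) := by
      rw [← hy, Matrix.star_mulVec, Matrix.conjTranspose_conjTranspose]
    rw [← Matrix.mulVec_mulVec, ← Matrix.mulVec_mulVec, hy, Matrix.dotProduct_mulVec, ← e3]
    simp [dotProduct, Matrix.mulVec, toComplex]
  by_contra hneg
  have hy0 := key y (by
    rw [hval]
    exact_mod_cast not_lt.1 hneg)
  apply hx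
  funext a
  have := congrFun hy a
  rw [hy0, Matrix.mulVec_zero] at this
  exact Complex.ofReal_eq_zero.1 this.symm

theorem det_ne_zero_of_norm_eq_one (hR : R.PosSemidef)
    (h : ∀ h : ℤ, (if h = 0 then R else 0) + bandCov p (withZeroth 1 A) 1 h
      = bandCov p (withZeroth 1 Θ) S h) {z : ℂ} (hz : ‖z‖ = 1)
    (hreg : ∀ y : Fin n → ℂ, (toComplex R).mulVec y = 0 →
      (matrixPoly p A z).conjTranspose.mulVec y = 0 → y = 0) :
    (matrixPoly p Θ z).det ≠ 0 := by
  have hΘu : IsUnit (matrixPoly p Θ z).conjTranspose := by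
    refine isUnit_of_mulVec_eq_zero fun y hy => ?_
    have := mulVec_eq_zero_of_spectral hR h hz (y := y) (le_of_eq (by
      rw [← Matrix.mulVec_mulVec, hy, Matrix.mulVec_zero, dotProduct_zero]))
    exact hreg y this.1 this.2
  rw [Matrix.isUnit_iff_isUnit_det, Matrix.det_conjTranspose] at hΘu
  exact fun h0 => by simp [h0] at hΘu

end Spectral

/-! ### Zeros of the moving average polynomial inside the disc -/

section Disc

variable {n p : ℕ} {E : Type*} [NormedAddCommGroup E] [InnerProductSpace ℝ E] [CompleteSpace E]

/-- If the noise lies in the closed span of the present and past of its moving average, the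
moving average polynomial has no zero in the open unit disc. -/
theorem det_ne_zero_of_norm_lt_one {x : ℤ → Fin n → E} {S : Matrix (Fin n) (Fin n) ℝ}
    (hx : ∀ s t, crossGram (x s) (x t) = if s = t then S else 0) (hS : IsUnit S.det)
    {Θ : ℕ → Matrix (Fin n) (Fin n) ℝ}
    (hpast : ∀ a, x 0 a ∈ pastSpan (movingAverage p (withZeroth 1 Θ) x) 1) {z : ℂ}
    (hz : ‖z‖ < 1) : (matrixPoly p Θ z).det ≠ 0 := by
  intro hdet
  obtain ⟨v, hv0, hv⟩ := Matrix.exists_mulVec_eq_zero_iff.2 hdet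
  -- The Hilbert space is real while the null vector is complex, so real functionals are applied
  -- first; real and imaginary parts suffice at the end.
  have key : ∀ (φ : ℂ →L[ℝ] ℝ) (a : Fin n), φ (v a) = 0 := by
    intro φ a
    set w : ℕ → Fin n → ℝ := fun k b => φ (z ^ k * v b) with hw
    have hsum : Summable fun k : ℕ => ∑ b, (S⁻¹.mulVec (w k)) b • x (-(k : ℤ)) b := by
      refine summable_sum fun b _ => ?_
      simp only [Matrix.mulVec, dotProduct, Finset.sum_smul]
      refine summable_sum fun c _ => ?_
      have hxb : ∀ k : ℕ, ‖x (-(k : ℤ)) b‖ = √(S b b) := fun k => by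
        rw [norm_eq_sqrt_real_inner, ← crossGram_apply, hx, if_pos rfl]
      refine Summable.of_norm_bounded (g := fun k => |S⁻¹ b c| * (‖φ‖ * ‖v c‖) * √(S b b) * ‖z‖ ^ k)
        ((summable_geometric_of_lt_one (norm_nonneg z) hz).mul_left _) fun k => ?_
      rw [norm_smul, hxb, norm_mul, Real.norm_eq_abs]
      have h1 : ‖w k c‖ ≤ ‖φ‖ * (‖z‖ ^ k * ‖v c‖) := by
        rw [← norm_pow, ← norm_mul]
        exact φ.le_opNorm _
      calc |S⁻¹ b c| * ‖w k c‖ * √(S b b)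
          ≤ |S⁻¹ b c| * (‖φ‖ * (‖z‖ ^ k * ‖v c‖)) * √(S b b) := by gcongr
        _ = _ := by ring
    -- Built so that its inner product with `x_{-m}` is `φ(z^m v)`; the series converges because
    -- `‖z‖ < 1`.
    set ψ : E := ∑' k : ℕ, ∑ b, (S⁻¹.mulVec (w k)) b • x (-(k : ℤ)) b with hψ
    have hxψ : ∀ (m : ℕ) (c : Fin n), inner ℝ (x (-(m : ℤ)) c) ψ = w m c := by
      intro m c
      have hterm : ∀ k : ℕ, inner ℝ (x (-(m : ℤ)) c)
          (∑ b, (S⁻¹.mulVec (w k)) b • x (-(k : ℤ)) b)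
          = (crossGram (x (-(m : ℤ))) (x (-(k : ℤ)))).mulVec (S⁻¹.mulVec (w k)) c := by
        intro k
        rw [inner_sum, Matrix.mulVec, dotProduct]
        exact Finset.sum_congr rfl fun b _ => by
          rw [inner_smul_right, crossGram_apply, mul_comm]
      have h1 := hsum.hasSum.mapL (innerSL ℝ (x (-(m : ℤ)) c))
      simp only [innerSL_apply_apply, hterm] at h1
      refine h1.unique ?_
      have h2 : (crossGram (x (-(m : ℤ))) (x (-(m : ℤ)))).mulVec (S⁻¹.mulVec (w m)) c = w m c := by
        rw [hx, if_pos rfl, Matrix.mulVec_mulVec, Matrix.mul_nonsing_inv _ hS, Matrix.one_mulVec]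
      rw [← h2]
      refine hasSum_single m fun k hk => ?_
      rw [hx, if_neg (by omega), Matrix.zero_mulVec, Pi.zero_apply]
    -- At time `-m` the inner product is `φ(z^m Θ(z) v)`, which is zero. As `x_0` lies in the closed
    -- span of these values, `φ(v)` must vanish as well.
    have hzψ : ∀ s < (1 : ℤ), ∀ b,
        inner ℝ (movingAverage p (withZeroth 1 Θ) x s b) ψ = 0 := by
      intro s hs b
      obtain ⟨m, hm⟩ := Int.eq_ofNat_of_zero_le (a := -s) (by omega)
      obtain rfl : s = -(m : ℤ) := by omega
      have hv' := congrFun hv b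
      rw [matrixPoly_eq_sum, Matrix.sum_mulVec, Finset.sum_apply, Pi.zero_apply] at hv'
      have hval : inner ℝ (movingAverage p (withZeroth 1 Θ) x (-(m : ℤ)) b) ψ
          = φ (z ^ m * ∑ i ∈ Finset.range (p + 1),
            ((z ^ i • toComplex (withZeroth 1 Θ i)).mulVec v) b) := by
        rw [movingAverage, Finset.sum_apply, sum_inner, Finset.mul_sum, map_sum]
        refine Finset.sum_congr rfl fun i _ => ?_
        rw [matAct, sum_inner, Matrix.mulVec, dotProduct, Finset.mul_sum, map_sum]
        refine Finset.sum_congr rfl fun c _ => ?_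
        have hi : -(m : ℤ) - i = -((m + i : ℕ) : ℤ) := by push_cast; ring
        rw [real_inner_smul_left, hi, hxψ, hw]
        simp only
        rw [← smul_eq_mul, ← map_smul]
        congr 1
        simp only [toComplex, Matrix.smul_apply, Matrix.map_apply, smul_eq_mul, Complex.real_smul]
        ring
      rw [hval, hv', mul_zero, map_zero]
    have h0 := inner_eq_zero_of_mem_pastSpan hzψ (hpast a)
    have h1 := hxψ 0 a
    rw [Nat.cast_zero, neg_zero, h0, hw] at h1
    simpa using h1.symm
  refine hv0 (funext fun a => Complex.ext ?_ ?_)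
  · exact key Complex.reCLM a
  · exact key Complex.imCLM a

end Disc

/-! ### Absolutely summable inverses -/

section Inverse

theorem PowerSeries.summable_norm_coeff_mul {f g : PowerSeries ℂ}
    (hf : Summable fun k => ‖PowerSeries.coeff k f‖)
    (hg : Summable fun k => ‖PowerSeries.coeff k g‖) :
    Summable fun k => ‖PowerSeries.coeff k (f * g)‖ := by
  refine (summable_norm_sum_mul_antidiagonal_of_summable_norm (f := fun k => PowerSeries.coeff k f)
    (g := fun k => PowerSeries.coeff k g) hf hg).congr fun k => ?_
  rw [PowerSeries.coeff_mul]

/-- A complex polynomial without roots in the closed unit disc has an absolutely summable inverse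
power series. -/
theorem exists_summable_mul_eq_one (q : Polynomial ℂ) (hq : ∀ z : ℂ, ‖z‖ ≤ 1 → q.eval z ≠ 0) :
    ∃ f : PowerSeries ℂ, (q : PowerSeries ℂ) * f = 1
      ∧ Summable fun k => ‖PowerSeries.coeff k f‖ := by
  have hq0 : q ≠ 0 := by rintro rfl; exact hq 0 (by simp) (by simp)
  have hlc : q.leadingCoeff ≠ 0 := Polynomial.leadingCoeff_ne_zero.2 hq0
  have hroots : ∀ s : Multiset ℂ, (∀ ρ ∈ s, 1 < ‖ρ‖) → ∃ f : PowerSeries ℂ,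
      (((s.map fun ρ => Polynomial.X - Polynomial.C ρ).prod : Polynomial ℂ) : PowerSeries ℂ) * f = 1
        ∧ Summable fun k => ‖PowerSeries.coeff k f‖ := by
    intro s
    induction s using Multiset.induction_on with
    | empty =>
      intro _
      refine ⟨1, by simp, summable_of_ne_finset_zero (s := {0}) fun k hk => ?_⟩
      rw [PowerSeries.coeff_one, if_neg (by simpa using hk), norm_zero]
    | cons ρ s ih =>
      intro hs
      obtain ⟨f, hf, hfs⟩ := ih fun σ hσ => hs σ (Multiset.mem_cons_of_mem hσ)
      have hρ := hs ρ (Multiset.mem_cons_self _ _)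
      have hρ0 : ρ ≠ 0 := by rintro rfl; simp at hρ; linarith
      -- The geometric expansion of `1 / (X - ρ)`, absolutely summable since `‖ρ‖ > 1`.
      refine ⟨PowerSeries.mk (fun k => -(ρ⁻¹ ^ (k + 1))) * f, ?_,
        PowerSeries.summable_norm_coeff_mul ?_ hfs⟩
      · have hg : ((Polynomial.X - Polynomial.C ρ : Polynomial ℂ) : PowerSeries ℂ)
            * PowerSeries.mk (fun k => -(ρ⁻¹ ^ (k + 1))) = 1 := by
          rw [Polynomial.coe_sub, Polynomial.coe_X, Polynomial.coe_C, sub_mul]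
          ext k
          rw [map_sub, PowerSeries.coeff_C_mul, PowerSeries.coeff_mk, PowerSeries.coeff_one]
          cases k with
          | zero => simp [hρ0]
          | succ k =>
            rw [PowerSeries.coeff_succ_X_mul, PowerSeries.coeff_mk, if_neg (Nat.succ_ne_zero k)]
            rw [pow_succ' _ (k + 1), mul_neg, mul_inv_cancel_left₀ hρ0, sub_self]
        rw [Multiset.map_cons, Multiset.prod_cons, Polynomial.coe_mul]
        calc _ = (((Polynomial.X - Polynomial.C ρ : Polynomial ℂ) : PowerSeries ℂ)
            * PowerSeries.mk (fun k => -(ρ⁻¹ ^ (k + 1)))) * (((s.map fun ρ =>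
              Polynomial.X - Polynomial.C ρ).prod : Polynomial ℂ) * f) := by ring
          _ = 1 := by rw [hg, hf, one_mul]
      · simp only [PowerSeries.coeff_mk, norm_neg, norm_pow, norm_inv]
        exact (summable_nat_add_iff 1).2 (summable_geometric_of_lt_one (by positivity)
          (inv_lt_one_of_one_lt₀ hρ))
  obtain ⟨f, hf, hfs⟩ := hroots q.roots fun ρ hρ => by
    by_contra h
    exact hq ρ (not_lt.1 h) (Polynomial.isRoot_of_mem_roots hρ)
  refine ⟨PowerSeries.C q.leadingCoeff⁻¹ * f, ?_, ?_⟩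
  · have hprod : (q : PowerSeries ℂ) = PowerSeries.C q.leadingCoeff *
        ((q.roots.map fun ρ => Polynomial.X - Polynomial.C ρ).prod : Polynomial ℂ) := by
      conv_lhs => rw [(IsAlgClosed.splits q).eq_prod_roots, Polynomial.coe_mul, Polynomial.coe_C]
    rw [hprod]
    calc _ = (PowerSeries.C q.leadingCoeff * PowerSeries.C q.leadingCoeff⁻¹) *
        ((((q.roots.map fun ρ => Polynomial.X - Polynomial.C ρ).prod : Polynomial ℂ)
          : PowerSeries ℂ) * f) := by ring
      _ = 1 := by rw [hf, mul_one, ← map_mul, mul_inv_cancel₀ hlc, map_one]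
  · simp only [PowerSeries.coeff_C_mul, norm_mul]
    exact hfs.mul_left _

/-- The real inverse series, read over `ℂ`, is the summable complex inverse, by uniqueness of
inverses. -/
theorem summable_coeff_inv (q : Polynomial ℝ)
    (hq : ∀ z : ℂ, ‖z‖ ≤ 1 → Polynomial.aeval z q ≠ 0) :
    (q : PowerSeries ℝ) * (q : PowerSeries ℝ)⁻¹ = 1
      ∧ Summable fun k => ‖PowerSeries.coeff k (q : PowerSeries ℝ)⁻¹‖ := by
  have h0 : PowerSeries.constantCoeff (q : PowerSeries ℝ) ≠ 0 := by
    intro h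
    apply hq 0 (by simp)
    rw [← PowerSeries.coeff_zero_eq_constantCoeff_apply, Polynomial.coeff_coe] at h
    simp [Polynomial.aeval_def, Polynomial.eval₂_at_zero, h]
  have hmul := PowerSeries.mul_inv_cancel _ h0
  refine ⟨hmul, ?_⟩
  obtain ⟨f, hf, hfs⟩ := exists_summable_mul_eq_one (q.map Complex.ofRealHom) fun z hz => by
    rw [Polynomial.eval_map]
    exact hq z hz
  have hmap := congrArg (PowerSeries.map Complex.ofRealHom) hmul
  rw [map_mul, map_one, ← Polynomial.polynomial_map_coe] at hmap
  have hfeq : f = PowerSeries.map Complex.ofRealHom (q : PowerSeries ℝ)⁻¹ :=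
    left_inv_eq_right_inv (by rw [mul_comm]; exact hf) hmap
  refine hfs.congr fun k => ?_
  rw [hfeq, PowerSeries.coeff_map]
  simp

variable {n p : ℕ}

/-- Cramer's rule for power series: `P` is the adjugate, which is polynomial, times the summable
inverse of the determinant. The last identity compares coefficients in `P(X) Θ(X) = I`. -/
theorem exists_summable_inverse {Θ : ℕ → Matrix (Fin n) (Fin n) ℝ}
    (h : ∀ z : ℂ, ‖z‖ ≤ 1 → (matrixPoly p Θ z).det ≠ 0) :
    ∃ P : ℕ → Matrix (Fin n) (Fin n) ℝ, (∀ a b, Summable fun j => |P j a b|) ∧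
      ∀ k, ∑ i ∈ Finset.range (p + 1), (if i ≤ k then P (k - i) * withZeroth 1 Θ i else 0)
        = if k = 0 then 1 else 0 := by
  set M := matrixPolyMatrix p Θ with hM
  obtain ⟨hinv, hsum⟩ := summable_coeff_inv M.det fun z hz => by
    rw [hM, aeval_det_matrixPolyMatrix]
    exact h z hz
  set g : PowerSeries ℝ := (M.det : PowerSeries ℝ)⁻¹ with hg
  have hcoeffM : ∀ i a b, (M a b).coeff i = if i ≤ p then withZeroth 1 Θ i a b else 0 := by
    intro i a b
    have : M = ∑ i ∈ Finset.range (p + 1),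
        (Polynomial.X : Polynomial ℝ) ^ i • (withZeroth 1 Θ i).map Polynomial.C := by
      rw [sum_withZeroth 1 Θ fun i A => (Polynomial.X : Polynomial ℝ) ^ i • A.map Polynomial.C, hM,
        matrixPolyMatrix, pow_zero, one_smul]
      congr 1
      ext a b
      simp [Matrix.one_apply, apply_ite]
    rw [this, Matrix.sum_apply, Polynomial.finsetSum_coeff]
    simp
  refine ⟨fun j => Matrix.of fun a b => PowerSeries.coeff j ((M.adjugate a b : PowerSeries ℝ) * g),
    fun a b => ?_, fun k => ?_⟩
  · simp only [Matrix.of_apply, ← Real.norm_eq_abs, PowerSeries.coeff_mul]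
    refine summable_norm_sum_mul_antidiagonal_of_summable_norm
      (f := fun k => PowerSeries.coeff k (M.adjugate a b : PowerSeries ℝ))
      (g := fun k => PowerSeries.coeff k g) ?_ hsum
    refine summable_of_ne_finset_zero (s := (M.adjugate a b).support) fun k hk => ?_
    rw [Polynomial.coeff_coe, Polynomial.notMem_support_iff.1 hk, norm_zero]
  · ext a b
    have h1 : ∑ c, ((M.adjugate a c : PowerSeries ℝ) * g) * (M c b : PowerSeries ℝ)
        = if a = b then 1 else 0 := by
      have h2 := congrArg (Polynomial.coeToPowerSeries.ringHom (R := ℝ))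
        (congrFun (congrFun M.adjugate_mul a) b)
      rw [Matrix.mul_apply, map_sum, Matrix.smul_apply, Matrix.one_apply, smul_eq_mul] at h2
      simp only [map_mul, Polynomial.coeToPowerSeries.ringHom_apply] at h2
      have h3 : ∑ c, ((M.adjugate a c : PowerSeries ℝ) * g) * (M c b : PowerSeries ℝ)
          = (∑ c, (M.adjugate a c : PowerSeries ℝ) * (M c b : PowerSeries ℝ)) * g := by
        rw [Finset.sum_mul]
        exact Finset.sum_congr rfl fun c _ => by ring
      rw [h3, h2, mul_right_comm, hinv, one_mul]
      split_ifs <;> simp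
    have h4 := congrArg (PowerSeries.coeff k) h1
    simp only [map_sum, PowerSeries.coeff_mul _ (_ * g)] at h4
    have hL : (∑ i ∈ Finset.range (p + 1), (if i ≤ k then (Matrix.of fun a b =>
        PowerSeries.coeff (k - i) ((M.adjugate a b : PowerSeries ℝ) * g)) * withZeroth 1 Θ i
          else 0)) a b = ∑ i ∈ Finset.range (p + 1), if i ≤ k then ∑ c, PowerSeries.coeff (k - i)
            ((M.adjugate a c : PowerSeries ℝ) * g) * withZeroth 1 Θ i c b else 0 := by
      rw [Matrix.sum_apply]
      refine Finset.sum_congr rfl fun i _ => ?_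
      split_ifs
      · rfl
      · rfl
    have hR : ∑ c, ∑ q ∈ Finset.HasAntidiagonal.antidiagonal k, PowerSeries.coeff q.1
          ((M.adjugate a c : PowerSeries ℝ) * g) * PowerSeries.coeff q.2 (M c b : PowerSeries ℝ)
        = ∑ i ∈ Finset.range (k + 1), if i ≤ p then ∑ c, PowerSeries.coeff (k - i)
            ((M.adjugate a c : PowerSeries ℝ) * g) * withZeroth 1 Θ i c b else 0 := by
      rw [Finset.sum_comm, ← Finset.Nat.sum_antidiagonal_swap,
        Finset.Nat.sum_antidiagonal_eq_sum_range_succ_mk]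
      refine Finset.sum_congr rfl fun i _ => ?_
      simp only [Prod.swap, Polynomial.coeff_coe, hcoeffM]
      split_ifs
      · rfl
      · simp
    rw [hL, ← Finset.sum_filter]
    rw [hR, ← Finset.sum_filter] at h4
    have hset : (Finset.range (p + 1)).filter (· ≤ k) = (Finset.range (k + 1)).filter (· ≤ p) := by
      ext i
      simp only [Finset.mem_filter, Finset.mem_range]
      omega
    rw [hset, h4]
    rcases eq_or_ne k 0 with rfl | hk
    · rw [if_pos rfl, Matrix.one_apply]
      split_ifs <;> simp
    · rw [if_neg hk, Matrix.zero_apply]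
      split_ifs
      · rw [PowerSeries.coeff_one, if_neg hk]
      · simp

/-- A statement about one path: the finite sum over `i` is exchanged with the series over `j`, and
regrouping by `k = i + j` leaves only `k = 0`. -/
theorem hasSum_mulVec_movingAverage {P B : ℕ → Matrix (Fin n) (Fin n) ℝ} {x : ℤ → Fin n → ℝ}
    (hPB : ∀ k, ∑ i ∈ Finset.range (p + 1), (if i ≤ k then P (k - i) * B i else 0)
        = if k = 0 then 1 else 0)
    (hsum : ∀ a b c t, Summable fun j : ℕ => P j a b * x (t - j) c) (t : ℤ) (a : Fin n) :
    HasSum (fun j : ℕ => (P j).mulVec (∑ i ∈ Finset.range (p + 1),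
      (B i).mulVec (x (t - j - i))) a) (x t a) := by
  have hs : ∀ i : ℕ, Summable fun j : ℕ => (P j * B i).mulVec (x (t - i - j)) a := by
    intro i
    simp only [Matrix.mulVec, dotProduct, Matrix.mul_apply, Finset.sum_mul]
    refine summable_sum fun c _ => summable_sum fun b _ => ?_
    refine ((hsum a b c (t - i)).mul_left (B i b c)).congr fun j => ?_
    ring
  have h1 : HasSum (fun j : ℕ => (P j).mulVec (∑ i ∈ Finset.range (p + 1),
      (B i).mulVec (x (t - j - i))) a)
      (∑ i ∈ Finset.range (p + 1), ∑' j : ℕ, (P j * B i).mulVec (x (t - i - j)) a) := by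
    refine (hasSum_sum fun i _ => (hs i).hasSum).congr_fun fun j => ?_
    rw [Matrix.mulVec_sum, Finset.sum_apply]
    refine Finset.sum_congr rfl fun i _ => ?_
    rw [Matrix.mulVec_mulVec, sub_right_comm]
  have h2 : HasSum (fun k : ℕ => if k = 0 then x t a else 0)
      (∑ i ∈ Finset.range (p + 1), ∑' j : ℕ, (P j * B i).mulVec (x (t - i - j)) a) := by
    have h3 : ∀ i ∈ Finset.range (p + 1), HasSum (fun k : ℕ =>
        ((if i ≤ k then P (k - i) * B i else 0).mulVec (x (t - k))) a)
        (∑' j : ℕ, (P j * B i).mulVec (x (t - i - j)) a) := by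
      intro i _
      rw [← hasSum_nat_add_iff' i, Finset.sum_eq_zero, sub_zero]
      · refine (hs i).hasSum.congr_fun fun j => ?_
        have ht : t - ((j + i : ℕ) : ℤ) = t - i - j := by push_cast; ring
        rw [if_pos (Nat.le_add_left i j), Nat.add_sub_cancel, ht]
      · intro k hk
        rw [if_neg (by simpa using hk), Matrix.zero_mulVec, Pi.zero_apply]
    refine (hasSum_sum h3).congr_fun fun k => ?_
    rw [← Finset.sum_apply, ← Matrix.sum_mulVec, hPB]
    split_ifs with hk
    · rw [hk, Nat.cast_zero, sub_zero, Matrix.one_mulVec]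
    · rw [Matrix.zero_mulVec, Pi.zero_apply]
  rw [h2.unique (hasSum_ite_eq 0 (x t a))] at h1
  exact h1

end Inverse

/-! ### Random vectors as vectors with entries in `L²` -/

section LTwo

variable {Ω : Type*} [MeasurableSpace Ω] {μ : Measure Ω}

/-- A random vector represented by a vector with entries in `L²`. -/
def rep {n : ℕ} (x : Fin n → Lp ℝ 2 μ) : Ω → Fin n → ℝ := fun ω a => x a ω

/-- The vector with entries in `L²` of a square integrable random vector. -/
def toLTwo {n : ℕ} (u : Ω → Fin n → ℝ) (hu : ∀ a, MemLp (fun ω => u ω a) 2 μ) :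
    Fin n → Lp ℝ 2 μ := fun a => (hu a).toLp

variable {m n : ℕ}

theorem ae_eq_iff_forall {u v : Ω → Fin n → ℝ} :
    u =ᵐ[μ] v ↔ ∀ a, (fun ω => u ω a) =ᵐ[μ] fun ω => v ω a := by
  rw [Filter.EventuallyEq]
  simp only [funext_iff]
  exact eventually_all

theorem eq_of_rep_ae_eq {x y : Fin n → Lp ℝ 2 μ} (h : rep x =ᵐ[μ] rep y) : x = y :=
  funext fun a => Lp.ext (ae_eq_iff_forall.1 h a)

theorem rep_toLTwo (u : Ω → Fin n → ℝ) (hu : ∀ a, MemLp (fun ω => u ω a) 2 μ) :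
    rep (toLTwo u hu) =ᵐ[μ] u :=
  ae_eq_iff_forall.2 fun a => (hu a).coeFn_toLp

theorem rep_add (x y : Fin n → Lp ℝ 2 μ) : rep (x + y) =ᵐ[μ] fun ω => rep x ω + rep y ω :=
  ae_eq_iff_forall.2 fun a => Lp.coeFn_add (x a) (y a)

theorem rep_sum {ι : Type*} (s : Finset ι) (x : ι → Fin n → Lp ℝ 2 μ) :
    rep (∑ i ∈ s, x i) =ᵐ[μ] fun ω => ∑ i ∈ s, rep (x i) ω := by
  refine ae_eq_iff_forall.2 fun a => ?_
  simp only [rep, Finset.sum_apply]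
  exact Lp.coeFn_fun_finsetSum s fun i => x i a

theorem rep_matAct (A : Matrix (Fin m) (Fin n) ℝ) (x : Fin n → Lp ℝ 2 μ) :
    rep (matAct A x) =ᵐ[μ] fun ω => A.mulVec (rep x ω) := by
  refine ae_eq_iff_forall.2 fun a => ?_
  have h : ∀ᵐ ω ∂μ, ∀ b, (A a b • x b : Lp ℝ 2 μ) ω = A a b * x b ω := by
    rw [eventually_all]
    exact fun b => Lp.coeFn_smul _ _
  filter_upwards [Lp.coeFn_fun_finsetSum Finset.univ fun b => A a b • x b, h] with ω h1 h2
  rw [rep, matAct, h1]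
  exact Finset.sum_congr rfl fun b _ => h2 b

theorem crossGram_eq_crossMoment_rep (x : Fin m → Lp ℝ 2 μ) (y : Fin n → Lp ℝ 2 μ) :
    crossGram x y = crossMoment μ (rep x) (rep y) := by
  ext a b
  rw [crossGram_apply, L2.inner_def, crossMoment, Matrix.of_apply]
  exact integral_congr_ae (Eventually.of_forall fun ω => mul_comm _ _)

theorem crossMoment_congr {u u' : Ω → Fin m → ℝ} {v v' : Ω → Fin n → ℝ} (hu : u =ᵐ[μ] u')
    (hv : v =ᵐ[μ] v') : crossMoment μ u v = crossMoment μ u' v' := by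
  ext a b
  refine integral_congr_ae ?_
  filter_upwards [hu, hv] with ω h1 h2
  rw [h1, h2]

theorem crossGram_toLTwo (u : Ω → Fin m → ℝ) (v : Ω → Fin n → ℝ)
    (hu : ∀ a, MemLp (fun ω => u ω a) 2 μ) (hv : ∀ a, MemLp (fun ω => v ω a) 2 μ) :
    crossGram (toLTwo u hu) (toLTwo v hv) = crossMoment μ u v := by
  rw [crossGram_eq_crossMoment_rep]
  exact crossMoment_congr (rep_toLTwo u hu) (rep_toLTwo v hv)

theorem MemLp.mulVec_apply {u : Ω → Fin n → ℝ} (hu : ∀ a, MemLp (fun ω => u ω a) 2 μ)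
    (A : Matrix (Fin m) (Fin n) ℝ) (a : Fin m) : MemLp (fun ω => A.mulVec (u ω) a) 2 μ := by
  simp only [Matrix.mulVec, dotProduct]
  exact memLp_finsetSum _ fun b _ => (hu b).const_mul _

theorem toLTwo_mulVec {u : Ω → Fin n → ℝ} (hu : ∀ a, MemLp (fun ω => u ω a) 2 μ)
    (A : Matrix (Fin m) (Fin n) ℝ) :
    toLTwo (fun ω => A.mulVec (u ω)) (MemLp.mulVec_apply hu A) = matAct A (toLTwo u hu) := by
  refine eq_of_rep_ae_eq ((rep_toLTwo _ _).trans ?_)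
  filter_upwards [rep_matAct A (toLTwo u hu), rep_toLTwo u hu] with ω h1 h2
  rw [h1, h2]

theorem crossMoment_mulVec {k l : ℕ} {u : Ω → Fin m → ℝ} {v : Ω → Fin n → ℝ}
    (hu : ∀ a, MemLp (fun ω => u ω a) 2 μ) (hv : ∀ a, MemLp (fun ω => v ω a) 2 μ)
    (A : Matrix (Fin k) (Fin m) ℝ) (B : Matrix (Fin l) (Fin n) ℝ) :
    crossMoment μ (fun ω => A.mulVec (u ω)) (fun ω => B.mulVec (v ω))
      = A * crossMoment μ u v * B.transpose := by
  rw [← crossGram_toLTwo _ _ (MemLp.mulVec_apply hu A) (MemLp.mulVec_apply hv B), toLTwo_mulVec hu,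
    toLTwo_mulVec hv, crossGram_matAct_left, crossGram_matAct_right, crossGram_toLTwo _ _ hu hv,
    Matrix.mul_assoc]

theorem IsWhiteNoise.mulVec [IsFiniteMeasure μ] {u : ℤ → Ω → Fin n → ℝ}
    {S : Matrix (Fin n) (Fin n) ℝ} (hu : IsWhiteNoise μ u S) (A : Matrix (Fin m) (Fin n) ℝ) :
    IsWhiteNoise μ (fun t ω => A.mulVec (u t ω)) (A * S * A.transpose) where
  memLp t := MemLp.mulVec_apply (hu.memLp t) A
  mean_zero t a := by
    simp only [Matrix.mulVec, dotProduct]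
    rw [integral_finsetSum _ fun b _ => ((hu.memLp t b).integrable one_le_two).const_mul _]
    exact Finset.sum_eq_zero fun b _ => by rw [integral_const_mul, hu.mean_zero, mul_zero]
  uncorrelated s t h := by
    rw [crossMoment_mulVec (hu.memLp s) (hu.memLp t), hu.uncorrelated s t h, Matrix.mul_zero,
      Matrix.zero_mul]
  covariance t := by
    rw [crossMoment_mulVec (hu.memLp t) (hu.memLp t), hu.covariance]

theorem IsWhiteNoise.crossGram_toLTwo {u : ℤ → Ω → Fin n → ℝ} {S : Matrix (Fin n) (Fin n) ℝ}
    (hu : IsWhiteNoise μ u S) (s t : ℤ) :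
    crossGram (toLTwo (u s) (hu.memLp s)) (toLTwo (u t) (hu.memLp t))
      = if s = t then S else 0 := by
  rw [_root_.crossGram_toLTwo]
  split_ifs with h
  · rw [h, hu.covariance]
  · exact hu.uncorrelated s t h

/-- With the mean as an inner product with the constant `1`, having mean zero passes to closed
spans. -/
theorem integral_eq_inner_one [IsFiniteMeasure μ] (x : Lp ℝ 2 μ) :
    ∫ ω, x ω ∂μ = inner ℝ x ((memLp_const (1 : ℝ)).toLp : Lp ℝ 2 μ) := by
  rw [L2.inner_def]
  refine integral_congr_ae ?_
  filter_upwards [(memLp_const (1 : ℝ) (μ := μ) (p := 2)).coeFn_toLp] with ω h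
  rw [h]
  simp

theorem integral_sq_eq_norm_sq (x : Lp ℝ 2 μ) : ∫ ω, (x ω) ^ 2 ∂μ = ‖x‖ ^ 2 := by
  rw [← real_inner_self_eq_norm_sq, L2.inner_def]
  exact integral_congr_ae (Eventually.of_forall fun ω => by simp [sq])

/-- Bounded norms and summable coefficients make the `L²` norms of the terms summable, which forces
absolute convergence almost everywhere. -/
theorem ae_summable_mul [IsFiniteMeasure μ] {x : ℕ → Lp ℝ 2 μ} {C : ℝ} (hx : ∀ j, ‖x j‖ ≤ C)
    {c : ℕ → ℝ} (hc : Summable fun j => |c j|) : ∀ᵐ ω ∂μ, Summable fun j => c j * x j ω := by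
  have h := summable_norm_of_tsum_eLpNorm_ne_top (μ := μ) (p := 2) (by norm_num)
    (f := fun j ω => c j * x j ω) (fun j => (Lp.aestronglyMeasurable (x j)).const_mul _) ?_
  · filter_upwards [h] with ω hω using hω.of_norm
  · have h1 : ∀ j, eLpNorm (fun ω => c j * x j ω) 2 μ ≤ ENNReal.ofReal (|c j| * C) := by
      intro j
      have h2 : eLpNorm (fun ω => c j * x j ω) 2 μ = ‖c j‖ₑ * ‖x j‖ₑ := by
        rw [Lp.enorm_def]
        exact eLpNorm_const_smul (c j) (x j) 2 μ
      rw [h2, ← ofReal_norm, ← ofReal_norm, ← ENNReal.ofReal_mul (norm_nonneg _)]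
      exact ENNReal.ofReal_le_ofReal (mul_le_mul_of_nonneg_left (hx j) (norm_nonneg _))
    exact ne_top_of_le_ne_top (hc.mul_right C).tsum_ofReal_ne_top (ENNReal.tsum_le_tsum h1)

end LTwo

/-! ### Moving averages observed with white noise -/

section SignalPlusNoise

variable {Ω : Type*} [MeasurableSpace Ω] {μ : Measure Ω} {n p : ℕ}

/-- The series `Y_t = u_t + e_t - ∑_{i=1}^p A_i e_{t-i}`, for uncorrelated white noises `u` and `e`
with covariance matrices `R` and `I`, is a moving average of order `p` of its innovations. -/
theorem vma_of_noise_add_movingAverage [IsProbabilityMeasure μ] {u e : ℤ → Ω → Fin n → ℝ}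
    {R : Matrix (Fin n) (Fin n) ℝ}
    (hu : IsWhiteNoise μ u R) (he : IsWhiteNoise μ e 1)
    (hue : ∀ s t, crossMoment μ (u s) (e t) = 0) (A : ℕ → Matrix (Fin n) (Fin n) ℝ)
    {Y : ℤ → Ω → Fin n → ℝ}
    (hY : ∀ t ω, Y t ω = u t ω + e t ω - ∑ i ∈ Finset.Icc 1 p, (A i).mulVec (e (t - (i : ℤ)) ω))
    (H : Prop) (hreg : H → ∀ z : ℂ, ‖z‖ = 1 → ∀ y : Fin n → ℂ, (toComplex R).mulVec y = 0 →
      (matrixPoly p (fun i => -A i) z).conjTranspose.mulVec y = 0 → y = 0) :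
    IsZeroMeanStationary μ Y ∧
      acvf μ Y 0 = R + 1 + ∑ i ∈ Finset.Icc 1 p, A i * (A i).transpose ∧
      (∀ h ∈ Finset.Icc 1 p, acvf μ Y (h : ℤ) = ∑ i ∈ Finset.range (p - h + 1),
        withZeroth (-1) A (i + h) * (withZeroth (-1) A i).transpose) ∧
      (∀ n, (innovCov (acvf μ Y) n).PosDef) ∧
      ∃ (ζ : ℤ → Ω → Fin n → ℝ) (S : Matrix (Fin n) (Fin n) ℝ)
        (Θ : ℕ → Matrix (Fin n) (Fin n) ℝ),
        IsVMA μ p Y ζ S Θ ∧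
        S.PosDef ∧
        IsInPastSpan μ Y ζ ∧
        (H → IsInvertibleIn μ Y ζ ∧ ∀ z : ℂ, ‖z‖ ≤ 1 → (matrixPoly p Θ z).det ≠ 0) ∧
        Tendsto (fun n => innovCov (acvf μ Y) n) atTop (𝓝 S) ∧
        (∀ i ∈ Finset.Icc 1 p, Tendsto (fun n => innovCoef (acvf μ Y) n i) atTop (𝓝 (Θ i))) ∧
        IsTheMaximalSolution p (acvf μ Y) S Θ := by
  set B : ℕ → Matrix (Fin n) (Fin n) ℝ := withZeroth 1 fun i => -A i with hB
  set x : ℤ → Fin n → Lp ℝ 2 μ := fun t => toLTwo (e t) (he.memLp t) with hx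
  set v : ℤ → Fin n → Lp ℝ 2 μ := fun t => toLTwo (u t) (hu.memLp t) with hv
  have hxx : ∀ s t, crossGram (x s) (x t) = if s = t then 1 else 0 := he.crossGram_toLTwo
  have hvv : ∀ s t, crossGram (v s) (v t) = if s = t then R else 0 := hu.crossGram_toLTwo
  have hvx : ∀ s t, crossGram (v s) (x t) = 0 := fun s t => by
    rw [hv, hx, crossGram_toLTwo, hue]
  have hYmem : ∀ t a, MemLp (fun ω => Y t ω a) 2 μ := by
    intro t a
    simp only [hY, Pi.sub_apply, Pi.add_apply, Finset.sum_apply]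
    exact ((hu.memLp t a).add (he.memLp t a)).sub
      (memLp_finsetSum _ fun i _ => MemLp.mulVec_apply (he.memLp _) _ a)
  set y : ℤ → Fin n → Lp ℝ 2 μ := fun t => toLTwo (Y t) (hYmem t) with hy
  have hyv : ∀ t, y t = v t + movingAverage p B x t := by
    intro t
    refine eq_of_rep_ae_eq ((rep_toLTwo _ _).trans ?_)
    rw [hB, movingAverage_withZeroth]
    have hall : ∀ᵐ ω ∂μ, ∀ i : ℕ, rep (matAct (-A i) (x (t - i))) ω
        = (-A i).mulVec (e (t - i) ω) := by
      rw [ae_all_iff]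
      intro i
      filter_upwards [rep_matAct (-A i) (x (t - i)), rep_toLTwo _ (he.memLp (t - i))]
        with ω h1 h2
      rw [h1, h2]
    filter_upwards [rep_add (v t) (x t + ∑ i ∈ Finset.Icc 1 p, matAct (-A i) (x (t - i))),
      rep_add (x t) (∑ i ∈ Finset.Icc 1 p, matAct (-A i) (x (t - i))),
      rep_sum (Finset.Icc 1 p) (fun i : ℕ => matAct (-A i) (x (t - i))),
      rep_toLTwo _ (hu.memLp t), rep_toLTwo _ (he.memLp t), hall] with ω h1 h2 h3 h4 h5 h6
    rw [h1, h2, h3, h4, h5, hY, Finset.sum_congr rfl fun i _ => h6 i]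
    simp only [Matrix.neg_mulVec, Finset.sum_neg_distrib]
    abel
  set Γ : ℤ → Matrix (Fin n) (Fin n) ℝ := acvf μ Y with hΓdef
  have hvm : ∀ s t, crossGram (v s) (movingAverage p B x t) = 0 := by
    intro s t
    rw [movingAverage, crossGram_sum_right]
    exact Finset.sum_eq_zero fun i _ => by rw [crossGram_matAct_right, hvx, Matrix.zero_mul]
  have hmv : ∀ s t, crossGram (movingAverage p B x s) (v t) = 0 := fun s t => by
    rw [← crossGram_transpose, hvm, Matrix.transpose_zero]
  have hyy : ∀ s t, crossGram (y s) (y t)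
      = (if s - t = 0 then R else 0) + bandCov p B 1 (s - t) := by
    intro s t
    rw [hyv, hyv, crossGram_add_left, crossGram_add_right, crossGram_add_right, hvm, hmv, hvv,
      crossGram_movingAverage hxx, add_zero, zero_add]
    simp only [sub_eq_zero]
  have hΓ0 : ∀ h, Γ h = (if h = 0 then R else 0) + bandCov p B 1 h := by
    intro h
    have := hyy h 0
    rwa [hy, crossGram_toLTwo, sub_zero] at this
  have hΓ : ∀ s t, crossGram (y s) (y t) = Γ (s - t) := fun s t => by rw [hyy, hΓ0]
  have hband : ∀ h : ℤ, (p : ℤ) < h → Γ h = 0 := fun h hh => by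
    rw [hΓ0, if_neg (by omega), bandCov_eq_zero _ _ hh, zero_add]
  have hneg : ∀ h, Γ (-h) = (Γ h).transpose := fun h => by
    have h1 := hΓ 0 h
    have h2 := hΓ h 0
    rw [zero_sub] at h1
    rw [sub_zero] at h2
    rw [← h1, ← h2, crossGram_transpose]
  have hstat : IsZeroMeanStationary μ Y := by
    refine ⟨hYmem, fun t a => ?_, fun s t h => ?_⟩
    · simp only [hY, Pi.sub_apply, Pi.add_apply, Finset.sum_apply]
      have hi : ∀ i : ℕ, MemLp (fun ω => (A i).mulVec (e (t - i) ω) a) 2 μ := fun i =>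
        MemLp.mulVec_apply (he.memLp _) _ a
      have hui : Integrable (fun ω => u t ω a + e t ω a) μ :=
        ((hu.memLp t a).integrable one_le_two).add ((he.memLp t a).integrable one_le_two)
      rw [integral_sub hui
        (integrable_finsetSum _ fun i _ => (hi i).integrable one_le_two),
        integral_add ((hu.memLp t a).integrable one_le_two)
        ((he.memLp t a).integrable one_le_two), hu.mean_zero, he.mean_zero,
        integral_finsetSum _ fun i _ => (hi i).integrable one_le_two, Finset.sum_eq_zero]
      · simp
      · exact fun i _ => (he.mulVec (A i)).mean_zero (t - i) a
    · rw [← crossGram_toLTwo _ _ (hYmem (s + h)) (hYmem s),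
        ← crossGram_toLTwo _ _ (hYmem (t + h)) (hYmem t)]
      have h1 := hΓ (s + h) s
      have h2 := hΓ (t + h) t
      rw [add_sub_cancel_left] at h1 h2
      exact h1.trans h2.symm
  have hyx : ∀ t, crossGram (y t) (x t) = 1 := by
    intro t
    have := crossGram_movingAverage_left (p := p) hxx B t (Nat.zero_le p)
    rw [Nat.cast_zero, sub_zero] at this
    rw [hyv, crossGram_add_left, hvx, this, hB, withZeroth_zero, Matrix.one_mul, zero_add]
  have hyx' : ∀ s t, s < t → crossGram (y s) (x t) = 0 := by
    intro s t hst
    rw [hyv, crossGram_add_left, hvx, crossGram_movingAverage_of_lt hxx _ hst, zero_add]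
  -- The orthonormal vectors paired with the series are the noises `e_t`.
  have hlow : ∀ n, (innovCov Γ n - 1).PosSemidef :=
    innovCov_sub_one_posSemidef (x := fun k : ℕ => y k) (y := fun k : ℕ => x k)
      (fun j k => hΓ j k) (fun k => by rw [hxx, if_pos rfl]) (fun k => hyx k)
      fun j k hjk => hyx' j k (by omega)
  have hR : R.PosSemidef := by
    have := hvv 0 0
    rw [if_pos rfl] at this
    exact this ▸ crossGram_self_posSemidef (v 0)
  set S := crossGram (wold y 0) (wold y 0) with hS
  have hSlim : Tendsto (innovCov Γ) atTop (𝓝 S) := tendsto_innovCov hΓ hlow 0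
  have hSpd : S.PosDef := posDef_of_sub_one_posSemidef
    (posSemidef_of_tendsto hlow (hSlim.sub tendsto_const_nhds))
  set Θ : ℕ → Matrix (Fin n) (Fin n) ℝ := fun i => crossGram (y 0) (wold y (0 - i)) * S⁻¹ with hΘ
  have hΘlim : ∀ i ∈ Finset.Icc 1 p, Tendsto (fun N => innovCoef Γ N i) atTop (𝓝 (Θ i)) :=
    fun i hi => tendsto_innovCoef hΓ hlow hSlim 0 (Finset.mem_Icc.1 hi).1
  have hrep : ∀ t, y t = movingAverage p (withZeroth 1 Θ) (wold y) t := fun t => by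
    rw [movingAverage_withZeroth]
    exact eq_wold_add_sum hΓ hband hlow hSlim hΘlim t
  have hww : ∀ s t, crossGram (wold y s) (wold y t) = if s = t then S else 0 := by
    intro s t
    split_ifs with h
    · rw [h]
      exact tendsto_nhds_unique (tendsto_innovCov hΓ hlow t) hSlim
    · exact crossGram_wold_of_ne h
  have hΓS : ∀ h, Γ h = bandCov p (withZeroth 1 Θ) S h := by
    intro h
    have := hΓ h 0
    rw [hrep, hrep, crossGram_movingAverage hww, sub_zero] at this
    exact this.symm
  have hae : ∀ᵐ ω ∂μ, ∀ t : ℤ, Y t ω = ∑ i ∈ Finset.range (p + 1),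
      (withZeroth 1 Θ i).mulVec (rep (wold y (t - i)) ω) := by
    rw [ae_all_iff]
    intro t
    have hall : ∀ᵐ ω ∂μ, ∀ i : ℕ, rep (matAct (withZeroth 1 Θ i) (wold y (t - i))) ω
        = (withZeroth 1 Θ i).mulVec (rep (wold y (t - i)) ω) :=
      ae_all_iff.2 fun i => rep_matAct _ _
    have hyrep : rep (y t) =ᵐ[μ] fun ω => ∑ i ∈ Finset.range (p + 1),
        rep (matAct (withZeroth 1 Θ i) (wold y (t - i))) ω := by
      rw [hrep t, movingAverage]
      exact rep_sum _ _
    filter_upwards [rep_toLTwo (Y t) (hYmem t), hyrep, hall] with ω h1 h2 h3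
    rw [← h1]
    exact h2.trans (Finset.sum_congr rfl fun i _ => h3 i)
  refine ⟨hstat, ?_, fun h hh => ?_, fun n => posDef_of_sub_one_posSemidef (hlow n),
    fun t => rep (wold y t), S, Θ, ⟨⟨fun t a => Lp.memLp _, fun t a => ?_, fun s t hst => ?_,
      fun t => ?_⟩, fun t => ?_⟩, hSpd, fun t δ hδ => ?_, fun hH => ?_, hSlim, hΘlim,
      solvesVMASystem_of_eq_bandCov ?_ hΓS, fun S' Θ' hsol => ?_⟩
  · rw [hΓ0, if_pos rfl, bandCov_withZeroth_zero, ← add_assoc]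
    simp
  · rw [hΓ0, if_neg (by have := (Finset.mem_Icc.1 hh).1; omega), zero_add,
      bandCov_natCast _ _ (Finset.mem_Icc.1 hh).2]
    simp only [withZeroth_neg, Matrix.mul_one, Matrix.transpose_neg, neg_mul_neg, hB]
  · have h1 := integral_eq_inner_one (wold y t a)
    refine h1.trans (inner_eq_zero_of_mem_pastSpan (fun s _ b => ?_)
      (wold_mem_pastSpan y (lt_add_one t) a))
    rw [← integral_eq_inner_one, ← hstat.mean_zero s b]
    exact integral_congr_ae (hYmem s b).coeFn_toLp
  · rw [← crossGram_eq_crossMoment_rep, hww, if_neg hst]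
  · rw [← crossGram_eq_crossMoment_rep, hww, if_pos rfl]
  · filter_upwards [hae] with ω hω
    rw [hω t, sum_withZeroth 1 Θ fun i M => M.mulVec (rep (wold y (t - i)) ω), Matrix.one_mulVec,
      Nat.cast_zero, sub_zero]
  · obtain ⟨N, P, hP⟩ := exists_filter_near_wold hΓ hlow t (Real.sqrt_pos.2 hδ)
    refine ⟨N, P, fun a => ?_⟩
    have h1 := (Real.lt_sqrt (norm_nonneg _)).1 (hP a)
    rw [← integral_sq_eq_norm_sq] at h1
    refine lt_of_eq_of_lt (integral_congr_ae ?_) h1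
    have hall : ∀ᵐ ω ∂μ, ∀ j : ℕ, rep (matAct (P j) (y (t - j))) ω
        = (P j).mulVec (Y (t - j) ω) := by
      rw [ae_all_iff]
      intro j
      filter_upwards [rep_matAct (P j) (y (t - j)), rep_toLTwo _ (hYmem (t - j))] with ω h2 h3
      rw [h2, h3]
    filter_upwards [Lp.coeFn_sub (wold y t a)
      ((∑ j ∈ Finset.range N, matAct (P j) (y (t - (j : ℤ)))) a),
      rep_sum (Finset.range N) (fun j : ℕ => matAct (P j) (y (t - (j : ℤ)))), hall]
      with ω h2 h3 h4
    rw [h2, Pi.sub_apply]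
    have h5 := congrFun h3 a
    rw [rep] at h5
    rw [h5, Finset.sum_congr rfl fun i _ => h4 i]
    rfl
  -- Inside the disc no regularity is needed, since the errors lie in the span of present and past;
  -- `hreg` enters only on the circle.
  · have hdisc : ∀ z : ℂ, ‖z‖ ≤ 1 → (matrixPoly p Θ z).det ≠ 0 := by
      intro z hz
      rcases hz.lt_or_eq with hz | hz
      · refine det_ne_zero_of_norm_lt_one hww (isUnit_det_of_posDef hSpd) (fun a => ?_) hz
        rw [← funext hrep]
        exact wold_mem_pastSpan y zero_lt_one a
      · exact det_ne_zero_of_norm_eq_one hR (fun h => by rw [← hΓS, hΓ0]) hz (hreg hH z hz)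
    refine ⟨?_, hdisc⟩
    obtain ⟨P, hP, hPB⟩ := exists_summable_inverse hdisc
    refine ⟨P, hP, fun t => ?_⟩
    have hsum : ∀ᵐ ω ∂μ, ∀ (a b c : Fin n) (t : ℤ),
        Summable fun j : ℕ => P j a b * rep (wold y (t - j)) ω c := by
      simp only [eventually_all, ae_all_iff]
      intro a b c t
      refine ae_summable_mul (C := √(S c c)) (fun j => ?_) (hP a b)
      rw [norm_eq_sqrt_real_inner, ← crossGram_apply, hww, if_pos rfl]
    filter_upwards [hae, hsum] with ω h1 h2 a
    simp only [h1]
    exact hasSum_mulVec_movingAverage (x := fun s => rep (wold y s) ω) hPB h2 t a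
  · rw [Matrix.IsSymm, hS, crossGram_transpose]
  · have hΓ' := hsol.eq_bandCov hneg hband
    have hS' : S'.PosDef := posDef_of_spectral hR hsol.symmetric fun h => by rw [← hΓ', hΓ0]
    -- The white noise `C'e` has covariance `C'C` and lives in the same `L²`, so no larger
    -- probability space is required.
    obtain ⟨C, rfl⟩ := hS'.posSemidef.exists_eq_transpose_mul
    refine maximal_of_tendsto hlow hSlim hΘlim (x := fun t => matAct C.transpose (x t))
      (fun s t => ?_) hΓ'
    rw [crossGram_matAct_left, crossGram_matAct_right, hxx]
    split_ifs <;> simp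

end SignalPlusNoise

-- Reduction of the factor model to a moving average plus noise.

section FactorModel

/-- The normalization `Λ'Λ = d I` gives `Λ'Φ̃_i = Φ_i Λ'`, so `Λ'` carries the lifted filter on `ε`
to the original filter on `Λ'ε/√d`. -/
theorem reducedSeries_residualSeries {Ω : Type*} {d r p : ℕ} {Λ : Matrix (Fin d) (Fin r) ℝ}
    {Φ : ℕ → Matrix (Fin r) (Fin r) ℝ} {η : ℤ → Ω → Fin r → ℝ} {ε : ℤ → Ω → Fin d → ℝ} (hd : 0 < d)
    (hΛ : Λ.transpose * Λ = (d : ℝ) • (1 : Matrix (Fin r) (Fin r) ℝ)) (t : ℤ) (ω : Ω) :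
    reducedSeries Λ (residualSeries p Λ Φ η ε) t ω
      = (√(d : ℝ) • (1 : Matrix (Fin r) (Fin r) ℝ)).mulVec (η t ω)
        + ((1 / √(d : ℝ)) • Λ.transpose).mulVec (ε t ω)
        - ∑ i ∈ Finset.Icc 1 p,
          (Φ i).mulVec (((1 / √(d : ℝ)) • Λ.transpose).mulVec (ε (t - (i : ℤ)) ω)) := by
  have hd0 : (d : ℝ) ≠ 0 := Nat.cast_ne_zero.2 hd.ne'
  have hs0 : √(d : ℝ) ≠ 0 := (Real.sqrt_pos.2 (Nat.cast_pos.2 hd)).ne'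
  rw [reducedSeries, residualSeries, Matrix.mulVec_sub, Matrix.mulVec_add, smul_sub, smul_add,
    Matrix.mulVec_sum, Finset.smul_sum]
  congr 1
  · congr 1
    · rw [Matrix.mulVec_mulVec, hΛ, Matrix.smul_mulVec, Matrix.smul_mulVec, smul_smul]
      congr 1
      rw [one_div_mul_eq_div, Real.div_sqrt]
    · rw [Matrix.smul_mulVec]
  · refine Finset.sum_congr rfl fun i _ => ?_
    have h1 : Λ.transpose * liftedCoef Λ (Φ i) = Φ i * Λ.transpose := by
      rw [liftedCoef, Matrix.mul_smul, Matrix.mul_assoc, ← Matrix.mul_assoc, hΛ, Matrix.smul_mul,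
        Matrix.one_mul, smul_smul, one_div, inv_mul_cancel₀ hd0, one_smul]
    rw [Matrix.mulVec_mulVec, h1, Matrix.smul_mulVec, Matrix.mulVec_smul, Matrix.mulVec_mulVec]

variable {Ω : Type*} [MeasurableSpace Ω] {μ : Measure Ω} {d r p : ℕ}
  {Λ : Matrix (Fin d) (Fin r) ℝ} {Φ : ℕ → Matrix (Fin r) (Fin r) ℝ}
  {Qη : Matrix (Fin r) (Fin r) ℝ} {X : ℤ → Ω → Fin d → ℝ} {f η : ℤ → Ω → Fin r → ℝ}
  {ε : ℤ → Ω → Fin d → ℝ}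

/-- By the autoregression `η_s` is a combination of factors, all uncorrelated with `ε_t`. -/
theorem IsDFM.crossMoment_noise_error (hX : IsDFM μ p Λ Φ Qη X f η ε) (s t : ℤ) :
    crossMoment μ (η s) (ε t) = 0 := by
  have hf := hX.factor_stationary.memLp
  have hη := hX.noise_factor.memLp
  have hε := hX.noise_error.memLp
  set F : ℤ → Fin r → Lp ℝ 2 μ := fun s => toLTwo (f s) (hf s) with hF
  have hvar : F s = (∑ i ∈ Finset.Icc 1 p, matAct (Φ i) (F (s - i))) + toLTwo (η s) (hη s) := by
    refine eq_of_rep_ae_eq ((rep_toLTwo _ _).trans ?_)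
    have hall : ∀ᵐ ω ∂μ, ∀ i : ℕ, rep (matAct (Φ i) (F (s - i))) ω
        = (Φ i).mulVec (f (s - i) ω) := by
      rw [ae_all_iff]
      intro i
      filter_upwards [rep_matAct (Φ i) (F (s - i)), rep_toLTwo _ (hf (s - i))] with ω h1 h2
      rw [h1, h2]
    filter_upwards [rep_add (∑ i ∈ Finset.Icc 1 p, matAct (Φ i) (F (s - i)))
      (toLTwo (η s) (hη s)), rep_sum (Finset.Icc 1 p) fun i : ℕ => matAct (Φ i) (F (s - i)),
      rep_toLTwo _ (hη s), hall, hX.factor_var s] with ω h1 h2 h3 h4 h5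
    rw [h1, h2, h3, h5, Finset.sum_congr rfl fun i _ => h4 i]
  have hfε : ∀ s, crossGram (F s) (toLTwo (ε t) (hε t)) = 0 := fun s => by
    rw [← crossGram_transpose, hF, crossGram_toLTwo, hX.error_factor_uncorrelated,
      Matrix.transpose_zero]
  have h := hfε s
  rw [hvar, crossGram_add_left, crossGram_sum_left, Finset.sum_eq_zero, zero_add,
    crossGram_toLTwo] at h
  · exact h
  · intro i _
    rw [crossGram_matAct_left, hfε, Matrix.mul_zero]

theorem toComplex_transpose_mul_self (hΛ : Λ.transpose * Λ = (d : ℝ) • (1 : Matrix _ _ ℝ)) :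
    (toComplex Λ).conjTranspose * toComplex Λ = (d : ℂ) • (1 : Matrix (Fin r) (Fin r) ℂ) := by
  rw [conjTranspose_toComplex, ← toComplex_mul, hΛ, toComplex_smul, toComplex_one]
  simp

theorem matrixPoly_neg_liftedCoef (z : ℂ) :
    matrixPoly p (fun i => -liftedCoef Λ (Φ i)) z
      = 1 + (1 / (d : ℂ)) • (toComplex Λ * (matrixPoly p (fun i => -Φ i) z - 1)
        * (toComplex Λ).conjTranspose) := by
  rw [matrixPoly, matrixPoly, add_sub_cancel_left, Matrix.mul_sum, Matrix.sum_mul, Finset.smul_sum]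
  congr 1
  refine Finset.sum_congr rfl fun i _ => ?_
  have : toComplex (-liftedCoef Λ (Φ i)) = (1 / (d : ℂ)) • (toComplex Λ * toComplex (-Φ i)
      * (toComplex Λ).conjTranspose) := by
    rw [conjTranspose_toComplex, ← toComplex_mul, ← toComplex_mul, liftedCoef]
    ext a b
    simp [toComplex]
  change z ^ i • toComplex (-liftedCoef Λ (Φ i)) = _ • (_ * (z ^ i • toComplex (-Φ i)) * _)
  rw [this, smul_comm, Matrix.mul_smul, Matrix.smul_mul]

theorem mulVec_eq_zero_of_posDef_or {Q : Matrix (Fin r) (Fin r) ℝ}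
    (h : Q.PosDef ∨ ∀ z : ℂ, ‖z‖ = 1 → (matrixPoly p (fun i => -Φ i) z).det ≠ 0) {z : ℂ}
    (hz : ‖z‖ = 1) {y : Fin r → ℂ} (h1 : (toComplex Q).mulVec y = 0)
    (h2 : (matrixPoly p (fun i => -Φ i) z).conjTranspose.mulVec y = 0) : y = 0 := by
  rcases h with h | h
  · refine Matrix.eq_zero_of_mulVec_eq_zero (M := toComplex Q) ?_ h1
    have hdet : (toComplex Q).det = ((Q.det : ℝ) : ℂ) := (Complex.ofRealHom.map_det Q).symm
    rw [hdet]
    exact_mod_cast h.det_pos.ne'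
  · refine Matrix.eq_zero_of_mulVec_eq_zero ?_ h2
    rw [Matrix.det_conjTranspose]
    exact star_ne_zero.2 (h z hz)

/-- Put `w = Λ'y`. Applying `Λ'` to the two equations for `y` gives the corresponding equations for
`w` in dimension `r`, so `w = 0`. The lifted polynomial differs from the identity only through
`Λ'y`, whence `y = 0`. -/
theorem lifted_mulVec_eq_zero (hd : 0 < d)
    (hΛ : Λ.transpose * Λ = (d : ℝ) • (1 : Matrix (Fin r) (Fin r) ℝ))
    (h : Qη.PosDef ∨ ∀ z : ℂ, ‖z‖ = 1 → (matrixPoly p (fun i => -Φ i) z).det ≠ 0) {z : ℂ}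
    (hz : ‖z‖ = 1) {y : Fin d → ℂ} (h1 : (toComplex (Λ * Qη * Λ.transpose)).mulVec y = 0)
    (h2 : (matrixPoly p (fun i => -liftedCoef Λ (Φ i)) z).conjTranspose.mulVec y = 0) :
    y = 0 := by
  have hd0 : (d : ℂ) ≠ 0 := Nat.cast_ne_zero.2 hd.ne'
  have hΛc := toComplex_transpose_mul_self hΛ
  set L := toComplex Λ with hL
  set w := L.conjTranspose.mulVec y with hw
  set N := matrixPoly p (fun i => -Φ i) z with hN
  have hy : y + (1 / (d : ℂ)) • L.mulVec ((N - 1).conjTranspose.mulVec w) = 0 := by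
    rw [matrixPoly_neg_liftedCoef] at h2
    rw [← h2, hw]
    simp only [Matrix.conjTranspose_add, Matrix.conjTranspose_one, Matrix.conjTranspose_smul,
      Matrix.conjTranspose_mul, Matrix.conjTranspose_conjTranspose, Matrix.add_mulVec,
      Matrix.one_mulVec, Matrix.smul_mulVec, Matrix.mulVec_mulVec, Matrix.mul_assoc, ← hN, ← hL]
    simp
  have hw0 : w = 0 := by
    refine mulVec_eq_zero_of_posDef_or h hz ?_ ?_
    · rw [toComplex_mul, toComplex_mul, ← conjTranspose_toComplex, ← Matrix.mulVec_mulVec, ← hL,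
        ← hw, ← Matrix.mulVec_mulVec] at h1
      have := congrArg L.conjTranspose.mulVec h1
      rw [Matrix.mulVec_mulVec, hΛc, Matrix.smul_mulVec, Matrix.one_mulVec, Matrix.mulVec_zero]
        at this
      exact (smul_eq_zero.1 this).resolve_left hd0
    · have := congrArg L.conjTranspose.mulVec hy
      rw [Matrix.mulVec_add, Matrix.mulVec_smul, Matrix.mulVec_mulVec _ L.conjTranspose L, hΛc,
        Matrix.smul_mulVec, Matrix.one_mulVec, Matrix.mulVec_zero, smul_smul, one_div,
        inv_mul_cancel₀ hd0, one_smul, ← hw, Matrix.conjTranspose_sub, Matrix.sub_mulVec,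
        Matrix.conjTranspose_one, Matrix.one_mulVec, add_sub_cancel] at this
      exact this
  rw [hw0, Matrix.mulVec_zero, Matrix.mulVec_zero, smul_zero, add_zero] at hy
  exact hy

end FactorModel

end

theorem theorem4p2 {Ω : Type*} [MeasurableSpace Ω] (μ : Measure Ω) [IsProbabilityMeasure μ]
    (d r p : ℕ) (hd : 0 < d)
    (Λ : Matrix (Fin d) (Fin r) ℝ) (Φ : ℕ → Matrix (Fin r) (Fin r) ℝ)
    (Qη : Matrix (Fin r) (Fin r) ℝ)
    (X : ℤ → Ω → Fin d → ℝ) (f : ℤ → Ω → Fin r → ℝ)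
    (η : ℤ → Ω → Fin r → ℝ) (ε : ℤ → Ω → Fin d → ℝ)
    (hX : IsDFM μ p Λ Φ Qη X f η ε)
    (Z : ℤ → Ω → Fin d → ℝ) (hZ : Z = residualSeries p Λ Φ η ε)
    (W : ℤ → Ω → Fin r → ℝ) (hW : W = reducedSeries Λ Z)
    (Φt : ℕ → Matrix (Fin d) (Fin d) ℝ) (hΦt : ∀ i, Φt i = liftedCoef Λ (Φ i)) :
    -- the residual series
    (IsZeroMeanStationary μ Z ∧
      acvf μ Z 0 = Λ * Qη * Λ.transpose + 1
        + ∑ i ∈ Finset.Icc 1 p, Φt i * (Φt i).transpose ∧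
      (∀ h ∈ Finset.Icc 1 p, acvf μ Z (h : ℤ) = ∑ i ∈ Finset.range (p - h + 1),
        withZeroth (-1) Φt (i + h) * (withZeroth (-1) Φt i).transpose) ∧
      (∀ n, (innovCov (acvf μ Z) n).PosDef) ∧
      ∃ (ζ : ℤ → Ω → Fin d → ℝ) (Sζ : Matrix (Fin d) (Fin d) ℝ)
        (Θ : ℕ → Matrix (Fin d) (Fin d) ℝ),
        IsVMA μ p Z ζ Sζ Θ ∧
        Sζ.PosDef ∧
        IsInPastSpan μ Z ζ ∧
        ((Qη.PosDef ∨ ∀ z : ℂ, ‖z‖ = 1 → (matrixPoly p (fun i => -Φ i) z).det ≠ 0) →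
          IsInvertibleIn μ Z ζ ∧ ∀ z : ℂ, ‖z‖ ≤ 1 → (matrixPoly p Θ z).det ≠ 0) ∧
        Tendsto (fun n => innovCov (acvf μ Z) n) atTop (𝓝 Sζ) ∧
        (∀ i ∈ Finset.Icc 1 p, Tendsto (fun n => innovCoef (acvf μ Z) n i) atTop (𝓝 (Θ i))) ∧
        IsTheMaximalSolution p (acvf μ Z) Sζ Θ) ∧
    -- the reduced series
    (IsZeroMeanStationary μ W ∧
      acvf μ W 0 = 1 + (d : ℝ) • Qη + ∑ i ∈ Finset.Icc 1 p, Φ i * (Φ i).transpose ∧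
      (∀ h ∈ Finset.Icc 1 p, acvf μ W (h : ℤ) = ∑ i ∈ Finset.range (p - h + 1),
        withZeroth (-1) Φ (i + h) * (withZeroth (-1) Φ i).transpose) ∧
      (∀ n, (innovCov (acvf μ W) n).PosDef) ∧
      ∃ (ξ : ℤ → Ω → Fin r → ℝ) (Sξ : Matrix (Fin r) (Fin r) ℝ)
        (V : ℕ → Matrix (Fin r) (Fin r) ℝ),
        IsVMA μ p W ξ Sξ V ∧
        Sξ.PosDef ∧
        IsInPastSpan μ W ξ ∧
        ((Qη.PosDef ∨ ∀ z : ℂ, ‖z‖ = 1 → (matrixPoly p (fun i => -Φ i) z).det ≠ 0) →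
          IsInvertibleIn μ W ξ ∧ ∀ z : ℂ, ‖z‖ ≤ 1 → (matrixPoly p V z).det ≠ 0) ∧
        Tendsto (fun n => innovCov (acvf μ W) n) atTop (𝓝 Sξ) ∧
        (∀ i ∈ Finset.Icc 1 p, Tendsto (fun n => innovCoef (acvf μ W) n i) atTop (𝓝 (V i))) ∧
        IsTheMaximalSolution p (acvf μ W) Sξ V) := by

  subst hZ hW
  have hnoise := hX.crossMoment_noise_error
  have hs0 : √(d : ℝ) ≠ 0 := (Real.sqrt_pos.2 (Nat.cast_pos.2 hd)).ne'
  have hss : √(d : ℝ) * √(d : ℝ) = d := Real.mul_self_sqrt (Nat.cast_nonneg d)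
  obtain rfl : Φt = fun i => liftedCoef Λ (Φ i) := funext hΦt
  constructor
  · refine vma_of_noise_add_movingAverage (hX.noise_factor.mulVec Λ) hX.noise_error
      (fun s t => ?_) (fun i => liftedCoef Λ (Φ i)) (fun t ω => rfl) _
      fun h z hz y h1 h2 => lifted_mulVec_eq_zero hd hX.loadings h hz h1 h2
    have := crossMoment_mulVec (hX.noise_factor.memLp s) (hX.noise_error.memLp t) Λ
      (1 : Matrix (Fin d) (Fin d) ℝ)
    simpa [hnoise] using this
  -- The factor `1/√d` makes `Λ'ε/√d` a white noise with covariance `I_r`.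
  · have he := hX.noise_error.mulVec ((1 / √(d : ℝ)) • Λ.transpose)
    have hcov : ((1 / √(d : ℝ)) • Λ.transpose) * (1 : Matrix (Fin d) (Fin d) ℝ)
        * ((1 / √(d : ℝ)) • Λ.transpose).transpose = 1 := by
      rw [Matrix.mul_one, Matrix.transpose_smul, Matrix.transpose_transpose, Matrix.smul_mul,
        Matrix.mul_smul, hX.loadings, smul_smul, smul_smul]
      nth_rw 3 [← hss]
      field_simp
      simp
    rw [hcov] at he
    have hu := hX.noise_factor.mulVec (√(d : ℝ) • (1 : Matrix (Fin r) (Fin r) ℝ))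
    have hcov' : (√(d : ℝ) • (1 : Matrix (Fin r) (Fin r) ℝ)) * Qη
        * (√(d : ℝ) • (1 : Matrix (Fin r) (Fin r) ℝ)).transpose = (d : ℝ) • Qη := by
      rw [Matrix.transpose_smul, Matrix.transpose_one, Matrix.smul_mul, Matrix.one_mul,
        Matrix.mul_smul, Matrix.mul_one, smul_smul, hss]
    rw [hcov'] at hu
    have hmain := vma_of_noise_add_movingAverage hu he
      (fun s t => by
        rw [crossMoment_mulVec (hX.noise_factor.memLp s) (hX.noise_error.memLp t), hnoise,
          Matrix.mul_zero, Matrix.zero_mul])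
      Φ (fun t ω => reducedSeries_residualSeries hd hX.loadings t ω)
      (Qη.PosDef ∨ ∀ z : ℂ, ‖z‖ = 1 → (matrixPoly p (fun i => -Φ i) z).det ≠ 0)
      fun h z hz y h1 h2 => mulVec_eq_zero_of_posDef_or h hz (by
        rw [toComplex_smul, Matrix.smul_mulVec] at h1
        exact (smul_eq_zero.1 h1).resolve_left (by
          simpa using hd.ne')) h2
    rwa [add_comm ((d : ℝ) • Qη) 1] at hmain
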